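/- Let $A=\begin{pmatrix}2&1\\1&1\end{pmatrix}$, and let $G=\mathbb Z^2\rtimes_{A}\mathbb Z$ be the group of triples $((m,k),n)$ of integers with multiplication $(v,n)(v',n')=(v+A^nv',\,n+n')$. Let $\varphi$ be the automorphism $\varphi((m,k),n)=((k,-m),-n)$ of $G$. Let $\widehat G$ be the set of unitary equivalence classes of irreducible unitary representations of $G$ on complex Hilbert spaces, and let $\widehat\varphi:\widehat G\to\widehat G$, $\widehat\varphi[\rho]=[\rho\circ\varphi]$. Consider the following representations of $G$. - $\rho_1$ is the trivial representation on $\mathbb C$. - $\pi$ is the one-dimensional representation $\pi((m,k),n)=(-1)^n$. - $\rho_2$ is the representation on $\mathbb C^3$ with orthonormal basis $\varepsilon_1,\varepsilon_2,\varepsilon_3$ given by $\rho_2((m,k),0)\varepsilon_i=\chi_{A_i}(m,k)\,\varepsilon_i$ and $\rho_2((0,0),n)\varepsilon_i=\varepsilon_{i+n \bmod 3}$, where $A_1=(0,\tfrac12)$, $A_2=(\tfrac12,0)$, $A_3=(\tfrac12,\tfrac12)$ in $\mathbb T^2=(\mathbb R/\mathbb Z)^2$ and $\chi_{(x,y)}(m,k)=e^{2\pi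 i(mx+ky)}$. - $\rho_\infty$ is the representation on $L^2(\mathbb T^2)$ (Lebesgue measure) given by $(\rho_\infty(v,n)f)(t)=\chi_t(v)\,f(A^nt)$. Then the following hold. 1. The representations $\rho_1$, $\rho_2$, $\pi$, $\rho_2\otimes\pi$ are irreducible, and $\dim\rho_2=3$. There are exactly four classes of finite-dimensional irreducible unitary representations fixed by $\widehat\varphi$, namely $[\rho_1]$, $[\rho_2]$, $[\pi]$ and $[\rho_2\otimes\pi]$. 2. The equivalence relation $h\sim gh\varphi(g^{-1})$ on $G$ has exactly four classes (the Reidemeister classes of $\varphi$). For each $\rho\in\{\rho_1,\rho_2,\pi,\rho_2\otimes\pi\}$ let $S_\rho\neq0$ be any operator with $S_\rho\,\rho(g)=\rho(\varphi(g))\,S_\rho$ for all $g\in G$. Then each twisted character $g\mapsto\operatorname{Tr}(S_\rho\,\rho(g))$ is constant on every Reidemeister class, and the four twisted characters are linearly independent over $\mathbb C$. 3. The representation $\rho_\infty$ is infinite-dimensional and irreducible, and $\widehat\varphi[\rho_\infty]=[\rho_\infty]$. So $\widehat\varphi$ has at least one infinite-dimensional fixed point. -/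

import Mathlib

open MeasureTheory
open scoped TensorProduct

noncomputable section

/-! ### The group `ℤ² ⋊ ℤ` and its automorphism -/

/-- The hyperbolic matrix `A`. -/
def matA : Matrix.SpecialLinearGroup (Fin 2) ℤ := ⟨!![2, 1; 1, 1], by simp [Matrix.det_fin_two]⟩

/-- The matrix `M` of order four. -/
def matM : Matrix.SpecialLinearGroup (Fin 2) ℤ := ⟨!![0, 1; -1, 0], by simp [Matrix.det_fin_two]⟩

/-- `α : ℤ² → ℤ²`, `v ↦ A v`, written multiplicatively. -/
def alpha : MulAut (Multiplicative (Fin 2 → ℤ)) :=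
  AddEquiv.toMultiplicative (Matrix.SpecialLinearGroup.toLin' matA).toAddEquiv

/-- `μ : ℤ² → ℤ²`, `v ↦ M v`, written multiplicatively. -/
def mu : MulAut (Multiplicative (Fin 2 → ℤ)) :=
  AddEquiv.toMultiplicative (Matrix.SpecialLinearGroup.toLin' matM).toAddEquiv

/-- `ℤ² ⋊ ℤ`, the generator of `ℤ` acting on `ℤ²` by `α`. -/
abbrev SolGroup : Type :=
  Multiplicative (Fin 2 → ℤ) ⋊[zpowersHom (MulAut (Multiplicative (Fin 2 → ℤ))) alpha]
    Multiplicative ℤ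

/-- The element `((m, k), n)` of the group. -/
def SolGroup.mk (m k n : ℤ) : SolGroup :=
  ⟨Multiplicative.ofAdd ![m, k], Multiplicative.ofAdd n⟩

theorem alpha_ofAdd (m k : ℤ) :
    alpha (Multiplicative.ofAdd ![m, k]) = Multiplicative.ofAdd ![2 * m + k, m + k] := by
  apply Multiplicative.toAdd.injective
  ext i
  change (!![2, 1; 1, 1] : Matrix (Fin 2) (Fin 2) ℤ).toLin' ![m, k] i = ![2 * m + k, m + k] i
  fin_cases i <;> simp [Matrix.toLin'_apply, mul_comm]

theorem mu_ofAdd (m k : ℤ) :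
    mu (Multiplicative.ofAdd ![m, k]) = Multiplicative.ofAdd ![k, -m] := by
  apply Multiplicative.toAdd.injective
  ext i
  change (!![0, 1; -1, 0] : Matrix (Fin 2) (Fin 2) ℤ).toLin' ![m, k] i = ![k, -m] i
  fin_cases i <;> simp [Matrix.toLin'_apply]

theorem exists_ofAdd (v : Multiplicative (Fin 2 → ℤ)) :
    ∃ m k : ℤ, v = Multiplicative.ofAdd ![m, k] :=
  ⟨v.toAdd 0, v.toAdd 1, by
    apply Multiplicative.toAdd.injective
    ext i
    fin_cases i <;> simp⟩

theorem mu_mul_alpha : mu * alpha = alpha⁻¹ * mu := by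
  rw [eq_inv_mul_iff_mul_eq]
  refine MulEquiv.ext fun v => ?_
  obtain ⟨m, k, rfl⟩ := exists_ofAdd v
  simp only [MulAut.mul_apply, alpha_ofAdd, mu_ofAdd]
  congr 1
  ext i
  fin_cases i <;> simp <;> ring

/-- The automorphism `((m, k), n) ↦ ((k, -m), -n)`. -/
def phi : SolGroup ≃* SolGroup :=
  SemidirectProduct.congr mu (MulEquiv.inv (Multiplicative ℤ)) (by
    intro g
    have h : SemiconjBy mu (alpha ^ g.toAdd) (alpha⁻¹ ^ g.toAdd) :=
      SemiconjBy.zpow_right mu_mul_alpha _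
    refine MulEquiv.ext fun v => ?_
    have := DFunLike.congr_fun h.eq v
    simpa [zpowersHom_apply] using this)

theorem phi_mk (m k n : ℤ) : phi (SolGroup.mk m k n) = SolGroup.mk k (-m) (-n) := by
  refine SemidirectProduct.ext ?_ rfl
  exact mu_ofAdd m k

/-! ### Unitary representations and the unitary dual -/

/-- A unitary representation of a discrete group on a complex Hilbert space. -/
structure UnitaryRep (G : Type) [Group G] where
  /-- The underlying Hilbert space. -/
  H : Type
  [normed : NormedAddCommGroup H]
  [inner : InnerProductSpace ℂ H]
  [complete : CompleteSpace H]
  /-- The action by unitary operators. -/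
  toHom : G →* (H ≃ₗᵢ[ℂ] H)

attribute [instance] UnitaryRep.normed UnitaryRep.inner UnitaryRep.complete

namespace UnitaryRep

variable {G : Type} [Group G]

/-- Topological irreducibility: the space is nonzero and has no closed invariant subspaces other
than `0` and itself. -/
def IsIrreducible (ρ : UnitaryRep G) : Prop :=
  Nontrivial ρ.H ∧ ∀ K : Submodule ℂ ρ.H, IsClosed (K : Set ρ.H) →
    (∀ g, ∀ v ∈ K, ρ.toHom g v ∈ K) → K = ⊥ ∨ K = ⊤

/-- Unitary equivalence. -/
def Equivalent (ρ σ : UnitaryRep G) : Prop :=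
  ∃ U : ρ.H ≃ₗᵢ[ℂ] σ.H, ∀ g v, U (ρ.toHom g v) = σ.toHom g (U v)

theorem Equivalent.refl (ρ : UnitaryRep G) : ρ.Equivalent ρ :=
  ⟨LinearIsometryEquiv.refl ℂ ρ.H, fun _ _ => rfl⟩

theorem Equivalent.symm {ρ σ : UnitaryRep G} (h : ρ.Equivalent σ) : σ.Equivalent ρ := by
  obtain ⟨U, hU⟩ := h
  exact ⟨U.symm, fun g v => by rw [LinearIsometryEquiv.symm_apply_eq, hU]; simp⟩

theorem Equivalent.trans {ρ σ τ : UnitaryRep G} (h : ρ.Equivalent σ) (h' : σ.Equivalent τ) :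
    ρ.Equivalent τ := by
  obtain ⟨U, hU⟩ := h
  obtain ⟨V, hV⟩ := h'
  exact ⟨U.trans V, fun g v => by simp [hU, hV]⟩

/-- The representation `ρ ∘ φ`. -/
def comp (ρ : UnitaryRep G) (φ : G ≃* G) : UnitaryRep G where
  H := ρ.H
  toHom := ρ.toHom.comp φ.toMonoidHom

theorem IsIrreducible.comp {ρ : UnitaryRep G} (h : ρ.IsIrreducible) (φ : G ≃* G) :
    (ρ.comp φ).IsIrreducible :=
  ⟨h.1, fun K hK hinv => h.2 K hK fun g v hv => by
    have := hinv (φ.symm g) v hv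
    rwa [show (ρ.comp φ).toHom (φ.symm g) = ρ.toHom g from
      congrArg ρ.toHom (φ.apply_symm_apply g)] at this⟩

/-- The tensor product `g ↦ ρ(g) ⊗ σ(g)` of two finite-dimensional unitary representations (in
finite dimension the algebraic tensor product is already complete). -/
def tensor (ρ σ : UnitaryRep G) [FiniteDimensional ℂ ρ.H] [FiniteDimensional ℂ σ.H] :
    UnitaryRep G where
  H := ρ.H ⊗[ℂ] σ.H
  complete := FiniteDimensional.complete ℂ _
  toHom :=
    { toFun := fun g => TensorProduct.congrIsometry (ρ.toHom g) (σ.toHom g)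
      map_one' := by
        rw [map_one, map_one]
        exact TensorProduct.congrIsometry_refl_refl
      map_mul' := fun g h => by
        refine LinearIsometryEquiv.ext fun x => ?_
        induction x with
        | zero => simp
        | tmul v w => rw [map_mul, map_mul]; rfl
        | add x y hx hy => rw [map_add, hx, hy, map_add] }

end UnitaryRep

/-- Unitary equivalence as an equivalence relation on irreducible unitary representations. -/
def irrSetoid (G : Type) [Group G] : Setoid {ρ : UnitaryRep G // ρ.IsIrreducible} where
  r ρ σ := ρ.1.Equivalent σ.1
  iseqv := ⟨fun ρ => .refl ρ.1, fun h => h.symm, fun h h' => h.trans h'⟩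

/-- The unitary dual of `G`: equivalence classes of irreducible unitary representations. -/
def UnitaryDual (G : Type) [Group G] : Type 1 := Quotient (irrSetoid G)

namespace UnitaryDual

variable {G : Type} [Group G]

/-- The class `[ρ]` of an irreducible unitary representation. -/
def mk (ρ : UnitaryRep G) (h : ρ.IsIrreducible) : UnitaryDual G :=
  Quotient.mk (irrSetoid G) ⟨ρ, h⟩

/-- The map `[ρ] ↦ [ρ ∘ φ]` of the unitary dual induced by an automorphism `φ`. -/
def hat (φ : G ≃* G) : UnitaryDual G → UnitaryDual G :=
  Quotient.lift (fun ρ => mk (ρ.1.comp φ) (ρ.2.comp φ)) (by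
    rintro ρ σ ⟨U, hU⟩
    exact Quotient.sound ⟨U, fun g v => hU (φ g) v⟩)

/-- The class consists of finite-dimensional representations. -/
def IsFiniteDim : UnitaryDual G → Prop :=
  Quotient.lift (fun ρ => FiniteDimensional ℂ ρ.1.H) (by
    rintro ρ σ ⟨U, _⟩
    exact propext ⟨fun _ => U.toLinearEquiv.finiteDimensional,
      fun _ => U.symm.toLinearEquiv.finiteDimensional⟩)

end UnitaryDual

/-! ### Reidemeister classes and twisted characters -/

/-- Twisted conjugacy: `h ∼ g h φ(g⁻¹)`. -/
def reidemeisterSetoid {G : Type} [Group G] (φ : G ≃* G) : Setoid G where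
  r h h' := ∃ g : G, h' = g * h * φ g⁻¹
  iseqv :=
    { refl := fun h => ⟨1, by simp⟩
      symm := by
        rintro h _ ⟨g, rfl⟩
        exact ⟨g⁻¹, by simp [mul_assoc]⟩
      trans := by
        rintro h _ _ ⟨g, rfl⟩ ⟨g', rfl⟩
        exact ⟨g' * g, by simp [mul_assoc]⟩ }

/-- The set of Reidemeister classes of `φ`. -/
def ReidemeisterClass {G : Type} [Group G] (φ : G ≃* G) : Type := Quotient (reidemeisterSetoid φ)

/-- `S` is a nonzero intertwining operator from `ρ` to `ρ ∘ φ`. -/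
def IsTwistedIntertwiner {G : Type} [Group G] (φ : G ≃* G) (ρ : UnitaryRep G)
    (S : ρ.H →ₗ[ℂ] ρ.H) : Prop :=
  S ≠ 0 ∧ ∀ g v, S (ρ.toHom g v) = ρ.toHom (φ g) (S v)

/-- The twisted character `g ↦ Tr (S ρ(g))`. -/
def twistedChar {G : Type} [Group G] (ρ : UnitaryRep G) (S : ρ.H →ₗ[ℂ] ρ.H) (g : G) : ℂ :=
  LinearMap.trace ℂ ρ.H (S ∘ₗ (ρ.toHom g).toLinearEquiv.toLinearMap)

/-- The function is constant on each Reidemeister class. -/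
def IsConstOnReidemeister {G : Type} [Group G] (φ : G ≃* G) (f : G → ℂ) : Prop :=
  ∀ h h' : G, (reidemeisterSetoid φ) h h' → f h = f h'

/-! ### The representations -/

/-- The homomorphism out of `ℤ² ⋊ ℤ` given by `f` on `ℤ²` and by `n ↦ uⁿ` on `ℤ`. -/
def solLift {K : Type} [Group K] (f : Multiplicative (Fin 2 → ℤ) →* K) (u : K)
    (h : ∀ x, f (alpha x) = u * f x * u⁻¹) : SolGroup →* K :=
  SemidirectProduct.lift f (zpowersHom K u) (by
    intro g
    have hinv : ∀ x, f (alpha⁻¹ x) = (MulAut.conj u)⁻¹ (f x) := by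
      intro x
      have h2 := h (alpha⁻¹ x)
      rw [MulAut.apply_inv_self] at h2
      rw [← map_inv, MulAut.conj_apply, h2]
      group
    have key : ∀ (n : ℤ) (x : Multiplicative (Fin 2 → ℤ)),
        f ((alpha ^ n) x) = (MulAut.conj u ^ n) (f x) := by
      intro n
      induction n with
      | zero => simp
      | succ n ih => intro x; rw [zpow_add_one, zpow_add_one, MulAut.mul_apply, ih, h]; rfl
      | pred n ih => intro x; rw [zpow_sub_one, zpow_sub_one, MulAut.mul_apply, ih, hinv]; rfl
    refine MonoidHom.ext fun x => ?_
    simpa [zpowersHom_apply] using key g.toAdd x)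

/-- The action of `α` on the dual torus `𝕋² = (ℝ/ℤ)²`: `(x, y) ↦ (2x + y, x + y)`. -/
def torusAlpha : UnitAddTorus (Fin 2) ≃+ UnitAddTorus (Fin 2) where
  toFun t := ![2 • t 0 + t 1, t 0 + t 1]
  invFun t := ![t 0 - t 1, 2 • t 1 - t 0]
  left_inv t := by
    ext i
    fin_cases i <;> simp <;> abel
  right_inv t := by
    ext i
    fin_cases i <;> simp <;> abel
  map_add' s t := by
    ext i
    fin_cases i <;> simp <;> abel

/-- The character `(m, k) ↦ exp (2πi (m x + k y))` of `ℤ²` at the point `(x, y)` of `𝕋²`. -/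
def torusChar (t : UnitAddTorus (Fin 2)) : Multiplicative (Fin 2 → ℤ) →* Circle where
  toFun v := AddCircle.toCircle (v.toAdd 0 • t 0 + v.toAdd 1 • t 1)
  map_one' := by simp
  map_mul' v w := by
    rw [← AddCircle.toCircle_add]
    congr 1
    simp only [toAdd_mul, Pi.add_apply, add_smul]
    abel

theorem torusChar_alpha (t : UnitAddTorus (Fin 2)) (v : Multiplicative (Fin 2 → ℤ)) :
    torusChar t (alpha v) = torusChar (torusAlpha t) v := by
  obtain ⟨m, k, rfl⟩ := exists_ofAdd v
  rw [alpha_ofAdd]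
  simp only [torusChar, torusAlpha, MonoidHom.coe_mk, OneHom.coe_mk, toAdd_ofAdd, AddEquiv.coe_mk,
    Equiv.coe_fn_mk, Matrix.cons_val_zero, Matrix.cons_val_one]
  congr 1
  module

/-- The one-dimensional trivial representation `ρ₁`. -/
def rhoOne : UnitaryRep SolGroup where
  H := ℂ
  toHom := 1

/-- The one-dimensional representation `π((m, k), n) = (-1)ⁿ`. -/
def repPi : UnitaryRep SolGroup where
  H := ℂ
  toHom := solLift 1 (LinearIsometryEquiv.neg ℂ) (by simp)

/-- The points `A₁ = (0, 1/2)`, `A₂ = (1/2, 0)`, `A₃ = (1/2, 1/2)` of `𝕋²`. -/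
def orbitPoint : Fin 3 → UnitAddTorus (Fin 2) :=
  ![![0, ((1 / 2 : ℝ) : UnitAddCircle)], ![((1 / 2 : ℝ) : UnitAddCircle), 0],
    ![((1 / 2 : ℝ) : UnitAddCircle), ((1 / 2 : ℝ) : UnitAddCircle)]]

theorem torusAlpha_orbitPoint (i : Fin 3) : torusAlpha (orbitPoint i) = orbitPoint (i - 1) := by
  have h : ((1 / 2 : ℝ) : UnitAddCircle) + ((1 / 2 : ℝ) : UnitAddCircle) = 0 := by
    rw [← AddCircle.coe_add, add_halves]
    exact AddCircle.coe_period 1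
  ext j
  fin_cases i <;> fin_cases j <;>
    simp [torusAlpha, orbitPoint, two_nsmul, h, show (0 - 1 : Fin 3) = 2 from rfl,
      show (2 - 1 : Fin 3) = 1 from rfl, -one_div]

/-- Multiplication by a complex number of modulus one. -/
def circleScalar (c : Circle) : ℂ ≃ₗᵢ[ℂ] ℂ where
  toLinearEquiv := DistribMulAction.toLinearEquiv ℂ ℂ c
  norm_map' v := Circle.norm_smul c v

theorem circleScalar_apply (c : Circle) (z : ℂ) : circleScalar c z = c • z := rfl

/-- The diagonal action of `ℤ²` on `L²(A₁, A₂, A₃)`: `εᵢ ↦ χ_{Aᵢ}(m, k) εᵢ`. -/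
def rhoTwoDiag :
    Multiplicative (Fin 2 → ℤ) →* (EuclideanSpace ℂ (Fin 3) ≃ₗᵢ[ℂ] EuclideanSpace ℂ (Fin 3)) where
  toFun v := LinearIsometryEquiv.piLpCongrRight 2 fun i => circleScalar (torusChar (orbitPoint i) v)
  map_one' := by
    ext x i
    simp [circleScalar]
  map_mul' v w := by
    ext x i
    simp only [map_mul, LinearIsometryEquiv.coe_mul, Function.comp_apply,
      LinearIsometryEquiv.piLpCongrRight_apply, circleScalar_apply, mul_smul]

/-- The cyclic shift `εᵢ ↦ εᵢ₊₁`, indices modulo three. -/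
def rhoTwoShift : EuclideanSpace ℂ (Fin 3) ≃ₗᵢ[ℂ] EuclideanSpace ℂ (Fin 3) :=
  LinearIsometryEquiv.piLpCongrLeft 2 ℂ ℂ (Equiv.addRight (1 : Fin 3))

/-- The three-dimensional representation `ρ₂` on `L²(A₁, A₂, A₃)`. -/
def rhoTwo : UnitaryRep SolGroup where
  H := EuclideanSpace ℂ (Fin 3)
  toHom := solLift rhoTwoDiag rhoTwoShift (by
    intro v
    rw [eq_mul_inv_iff_mul_eq]
    ext x i
    have h : torusChar (orbitPoint i) (alpha v) = torusChar (orbitPoint (i - 1)) v := by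
      rw [torusChar_alpha, torusAlpha_orbitPoint]
    rw [sub_eq_add_neg] at h
    simp [rhoTwoDiag, rhoTwoShift, h, LinearIsometryEquiv.piLpCongrLeft_apply,
      Equiv.piCongrLeft', circleScalar_apply])

instance : FiniteDimensional ℂ rhoOne.H := inferInstanceAs (FiniteDimensional ℂ ℂ)
instance : FiniteDimensional ℂ repPi.H := inferInstanceAs (FiniteDimensional ℂ ℂ)
instance : FiniteDimensional ℂ rhoTwo.H :=
  inferInstanceAs (FiniteDimensional ℂ (EuclideanSpace ℂ (Fin 3)))

/-- Lebesgue (normalised Haar) measure on `𝕋²`. -/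
def torusMeasure : Measure (UnitAddTorus (Fin 2)) := Measure.pi fun _ => AddCircle.haarAddCircle

/-- The Hilbert space `L²(𝕋²)`. -/
abbrev TorusL2 : Type := Lp ℂ 2 torusMeasure

instance : torusMeasure.IsAddHaarMeasure :=
  inferInstanceAs (Measure.pi fun _ => AddCircle.haarAddCircle).IsAddHaarMeasure

theorem measurePreserving_torusAlpha :
    MeasurePreserving torusAlpha torusMeasure torusMeasure :=
  AddMonoidHom.measurePreserving (f := torusAlpha.toAddMonoidHom)
    (by
      refine continuous_pi fun i => ?_
      fin_cases i <;> simp [torusAlpha] <;> fun_prop)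
    torusAlpha.surjective rfl

theorem measurePreserving_torusAlpha_symm :
    MeasurePreserving torusAlpha.symm torusMeasure torusMeasure :=
  AddMonoidHom.measurePreserving (f := torusAlpha.symm.toAddMonoidHom)
    (by
      refine continuous_pi fun i => ?_
      fin_cases i <;> simp [torusAlpha] <;> fun_prop)
    torusAlpha.symm.surjective rfl

/-- The unitary operator `f ↦ f ∘ α` of `L²(𝕋²)`. -/
def torusCompAlpha : TorusL2 ≃ₗᵢ[ℂ] TorusL2 where
  toLinearEquiv :=
    LinearEquiv.ofLinearMap
      (Lp.compMeasurePreservingₗ ℂ torusAlpha measurePreserving_torusAlpha)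
      (Lp.compMeasurePreservingₗ ℂ torusAlpha.symm measurePreserving_torusAlpha_symm)
      (by
        refine LinearMap.ext fun f => Lp.ext ?_
        refine (Lp.coeFn_compMeasurePreserving _ measurePreserving_torusAlpha).trans ?_
        refine (measurePreserving_torusAlpha.quasiMeasurePreserving.ae_eq_comp
          (Lp.coeFn_compMeasurePreserving f measurePreserving_torusAlpha_symm)).trans ?_
        exact Filter.Eventually.of_forall fun t => by simp)
      (by
        refine LinearMap.ext fun f => Lp.ext ?_
        refine (Lp.coeFn_compMeasurePreserving _ measurePreserving_torusAlpha_symm).trans ?_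
        refine (measurePreserving_torusAlpha_symm.quasiMeasurePreserving.ae_eq_comp
          (Lp.coeFn_compMeasurePreserving f measurePreserving_torusAlpha)).trans ?_
        exact Filter.Eventually.of_forall fun t => by simp)
  norm_map' f := Lp.norm_compMeasurePreserving f measurePreserving_torusAlpha

theorem torusCompAlpha_coeFn (f : TorusL2) :
    torusCompAlpha f =ᵐ[torusMeasure] fun t => f (torusAlpha t) :=
  Lp.coeFn_compMeasurePreserving f measurePreserving_torusAlpha

theorem continuous_torusChar (v : Multiplicative (Fin 2 → ℤ)) :
    Continuous fun t => torusChar t v :=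
  AddCircle.continuous_toCircle.comp
    (((continuous_apply 0).zsmul _).add ((continuous_apply 1).zsmul _))

theorem continuous_coe_torusChar (v : Multiplicative (Fin 2 → ℤ)) :
    Continuous fun t => (torusChar t v : ℂ) :=
  continuous_subtype_val.comp (continuous_torusChar v)

theorem memLp_torusChar_mul (v : Multiplicative (Fin 2 → ℤ)) (f : TorusL2) :
    MemLp (fun t => (torusChar t v : ℂ) * f t) 2 torusMeasure :=
  (memLp_congr_norm
    ((continuous_coe_torusChar v).aestronglyMeasurable.mul (Lp.memLp f).1) (Lp.memLp f).1 (Filter.Eventually.of_forall fun t => by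
      rw [Pi.mul_apply, norm_mul, Circle.norm_coe, one_mul])).2 (Lp.memLp f)

/-- Multiplication by the function `t ↦ χ_t(v)`. -/
def torusMulFun (v : Multiplicative (Fin 2 → ℤ)) (f : TorusL2) : TorusL2 :=
  (memLp_torusChar_mul v f).toLp

theorem torusMulFun_coeFn (v : Multiplicative (Fin 2 → ℤ)) (f : TorusL2) :
    torusMulFun v f =ᵐ[torusMeasure] fun t => (torusChar t v : ℂ) * f t :=
  MemLp.coeFn_toLp _

theorem torusMulFun_one (f : TorusL2) : torusMulFun 1 f = f := by
  refine Lp.ext ((torusMulFun_coeFn 1 f).trans (Filter.Eventually.of_forall fun t => ?_))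
  simp

theorem torusMulFun_mul (v w : Multiplicative (Fin 2 → ℤ)) (f : TorusL2) :
    torusMulFun (v * w) f = torusMulFun v (torusMulFun w f) := by
  refine Lp.ext ?_
  filter_upwards [torusMulFun_coeFn (v * w) f, torusMulFun_coeFn v (torusMulFun w f),
    torusMulFun_coeFn w f] with t h1 h2 h3
  rw [h1, h2, h3, map_mul, Circle.coe_mul, mul_assoc]

theorem norm_torusMulFun (v : Multiplicative (Fin 2 → ℤ)) (f : TorusL2) :
    ‖torusMulFun v f‖ = ‖f‖ := by
  refine le_antisymm (Lp.norm_le_norm_of_ae_le ?_) (Lp.norm_le_norm_of_ae_le ?_) <;>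
  · filter_upwards [torusMulFun_coeFn v f] with t h
    rw [h, norm_mul, Circle.norm_coe, one_mul]

/-- The multiplication action of `ℤ²` on `L²(𝕋²)`: `f ↦ (t ↦ χ_t(m, k) f(t))`. -/
def torusMul : Multiplicative (Fin 2 → ℤ) →* (TorusL2 ≃ₗᵢ[ℂ] TorusL2) where
  toFun v :=
    { toFun := torusMulFun v
      invFun := torusMulFun v⁻¹
      left_inv := fun f => by rw [← torusMulFun_mul, inv_mul_cancel, torusMulFun_one]
      right_inv := fun f => by rw [← torusMulFun_mul, mul_inv_cancel, torusMulFun_one]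
      map_add' := fun f g => by
        refine Lp.ext ?_
        filter_upwards [torusMulFun_coeFn v (f + g), torusMulFun_coeFn v f, torusMulFun_coeFn v g,
          Lp.coeFn_add f g, Lp.coeFn_add (torusMulFun v f) (torusMulFun v g)] with t h1 h2 h3 h4 h5
        rw [h1, h5, Pi.add_apply, h2, h3, h4, Pi.add_apply, mul_add]
      map_smul' := fun c f => by
        refine Lp.ext ?_
        filter_upwards [torusMulFun_coeFn v (c • f), torusMulFun_coeFn v f,
          Lp.coeFn_smul c f, Lp.coeFn_smul c (torusMulFun v f)] with t h1 h2 h3 h4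
        rw [h1, RingHom.id_apply, h4, Pi.smul_apply, h2, h3, Pi.smul_apply, smul_eq_mul,
          smul_eq_mul, mul_left_comm]
      norm_map' := norm_torusMulFun v }
  map_one' := LinearIsometryEquiv.ext torusMulFun_one
  map_mul' v w := LinearIsometryEquiv.ext (torusMulFun_mul v w)

/-- The representation on `L²(𝕋²)` in which `(m, k) ∈ ℤ²` acts by multiplication by the character
`t ↦ χ_t(m, k)` and `n ∈ ℤ` acts by `f ↦ f ∘ αⁿ`. -/
def rhoTorus : UnitaryRep SolGroup where
  H := TorusL2
  toHom := solLift torusMul torusCompAlpha (by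
    intro v
    rw [eq_mul_inv_iff_mul_eq]
    refine LinearIsometryEquiv.ext fun f => Lp.ext ?_
    refine (torusMulFun_coeFn (alpha v) (torusCompAlpha f)).trans ?_
    refine Filter.EventuallyEq.trans ?_ (torusCompAlpha_coeFn (torusMulFun v f)).symm
    filter_upwards [torusCompAlpha_coeFn f,
      measurePreserving_torusAlpha.quasiMeasurePreserving.ae_eq_comp (torusMulFun_coeFn v f)]
      with t h1 h2
    simp only [Function.comp_apply] at h2
    rw [h1, h2, torusChar_alpha])

end

/-!
Restricted to `ℤ²`, a representation `ρ` of `ℤ² ⋊ ℤ` involves characters of `ℤ²`, on which the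
generator of `ℤ` acts through `α`. Two classes of representations matter here.

*Finite dimension.* A finite-dimensional irreducible `ρ` contains a joint eigenvector `x` of `ℤ²`,
with character `χ` say, and is spanned by the orbit of `x`. If `ρ ∘ φ ≅ ρ`, the intertwiner sends
`x` to an eigenvector whose character is `χ ∘ μ`, and this has to occur on the orbit of `x`, so
`χ ∘ μ = χ ∘ αⁿ` for some `n`. Since `μ` inverts `α` and `μ² = -1`, this gives `χ = χ⁻¹`
(`UnitaryRep.IsIrreducible.mul_self_eq_one_of_fixed`). The characters with values `±1` form two
cycles under `α`, of lengths `1` and `3`. If `k` is the length of the cycle of `χ`, the `k`-th power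
of the generator is a scalar by Schur's lemma, and because `φ` inverts the generator, this scalar
is `±1`. So `ρ` has a monomial basis in the sense of `UnitaryRep.IsMonomialBasis`, determined by
the cycle and a sign (`UnitaryRep.IsIrreducible.isMonomialBasis_of_fixed`); the four possibilities
are realised by `ρ₁`, `π`, `ρ₂` and `ρ₂ ⊗ π`. The same description computes the twisted
intertwiners and characters: `S bᵢ = s b₁₋ᵢ`, and on four representatives of the Reidemeister
classes the characters are nonzero multiples of the rows of a Hadamard matrix.

*The torus.* In the Fourier basis of `L²(𝕋²)`, indexed by `ℤ²`, the group `ℤ²` acts by translation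
and the generator of `ℤ` by the permutation `α`. Permuting the basis by `μ` gives the equivalence
with the twisted representation. The only `α`-invariant vectors are the constants, as the orbits of
`α` away from the origin are infinite and Fourier coefficients are square summable.

Irreducibility is proved in all cases by `UnitaryRep.isIrreducible_of_cyclic`: a cyclic vector which
is determined up to scalars by eigenvalue equations lies in each closed invariant subspace or in its
complement.
-/

open MeasureTheory
open scoped TensorProduct InnerProductSpace

/-! ### Generators and relations of the group -/

/-- The copy of `ℤ²` in the group. -/
abbrev IntLattice : Type := Multiplicative (Fin 2 → ℤ)

namespace SolGroup

/-- The inclusion of the normal subgroup `ℤ²`. -/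
def lat : IntLattice →* SolGroup := SemidirectProduct.inl

/-- The generator `(0, 1)` of the complement `ℤ`. -/
def gen : SolGroup := SemidirectProduct.inr (Multiplicative.ofAdd 1)

theorem gen_zpow (n : ℤ) : gen ^ n = SemidirectProduct.inr (Multiplicative.ofAdd n) := by
  rw [gen, ← map_zpow, ← ofAdd_zsmul, smul_eq_mul, mul_one]

theorem lat_mul_gen_zpow (g : SolGroup) : lat g.left * gen ^ g.right.toAdd = g := by
  rw [gen_zpow]
  exact SemidirectProduct.inl_left_mul_inr_right g

theorem gen_mul_lat (v : IntLattice) : gen * lat v = lat (alpha v) * gen := by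
  refine SemidirectProduct.ext ?_ ?_
  · simp [gen, lat, zpowersHom_apply]
  · simp [gen, lat]

theorem lat_mul (v : IntLattice) (g : SolGroup) :
    lat v * g = g * lat ((alpha ^ (-g.right.toAdd)) v) := by
  refine SemidirectProduct.ext ?_ ?_
  · simp [lat, zpowersHom_apply, mul_comm]
  · simp [lat]

theorem phi_lat (v : IntLattice) : phi (lat v) = lat (mu v) :=
  SemidirectProduct.ext rfl rfl

theorem phi_gen : phi gen = gen⁻¹ := by
  refine SemidirectProduct.ext ?_ rfl
  simp [gen, phi]

/-- The group is generated by `ℤ²` and the generator of `ℤ`. -/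
theorem generators_induction {P : SolGroup → Prop} (hlat : ∀ v, P (lat v)) (hgen : P gen)
    (hmul : ∀ g h, P g → P h → P (g * h)) (hinv : ∀ g, P g → P g⁻¹) (g : SolGroup) : P g := by
  have hone : P 1 := by simpa using hlat 1
  have hpow : ∀ n : ℕ, P (gen ^ n) := fun n => by
    induction n with
    | zero => simpa using hone
    | succ n ih => rw [pow_succ]; exact hmul _ _ ih hgen
  rw [← lat_mul_gen_zpow g]
  refine hmul _ _ (hlat _) ?_
  obtain ⟨n, hn | hn⟩ := Int.eq_nat_or_neg g.right.toAdd
  · rw [hn, zpow_natCast]; exact hpow n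
  · rw [hn, zpow_neg, zpow_natCast]; exact hinv _ (hpow n)

end SolGroup

theorem mu_mu (v : IntLattice) : mu (mu v) = v⁻¹ := by
  obtain ⟨m, k, rfl⟩ := exists_ofAdd v
  rw [mu_ofAdd, mu_ofAdd, ← ofAdd_neg]
  simp

theorem mu_alpha_zpow (n : ℤ) (v : IntLattice) :
    mu ((alpha ^ n) v) = (alpha ^ (-n)) (mu v) := by
  have h : SemiconjBy mu (alpha ^ n) (alpha⁻¹ ^ n) := SemiconjBy.zpow_right mu_mul_alpha _
  simpa using DFunLike.congr_fun h.eq v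

/-- `α³` is congruent to the identity modulo two. -/
theorem alpha_pow_three (v : IntLattice) :
    ∃ w : IntLattice, alpha (alpha (alpha v)) = v * (w * w) := by
  obtain ⟨m, k, rfl⟩ := exists_ofAdd v
  refine ⟨Multiplicative.ofAdd ![6 * m + 4 * k, 4 * m + 2 * k], ?_⟩
  rw [alpha_ofAdd, alpha_ofAdd, alpha_ofAdd, ← ofAdd_add, ← ofAdd_add]
  congr 1
  ext i
  fin_cases i <;> simp <;> ring

/-! ### Unitary representations -/

/-- Eigenvectors of a unitary operator for distinct eigenvalues are orthogonal. -/
theorem LinearIsometryEquiv.inner_eq_zero_of_eigenvector {H : Type*} [NormedAddCommGroup H]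
    [InnerProductSpace ℂ H] (T : H ≃ₗᵢ[ℂ] H) {x y : H} {a b : ℂ} (ha : ‖a‖ = 1)
    (hx : T x = a • x) (hy : T y = b • y) (hab : a ≠ b) : ⟪x, y⟫_ℂ = 0 := by
  by_contra hne
  have h := T.inner_map_map x y
  rw [hx, hy, inner_smul_left, inner_smul_right, ← mul_assoc, mul_eq_right₀ hne] at h
  have haa : a * starRingEnd ℂ a = 1 := by rw [Complex.mul_conj']; simp [ha]
  exact hab (mul_left_cancel₀ (left_ne_zero_of_mul_eq_one h) (by rw [h, mul_comm, haa]))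

namespace UnitaryRep

variable {G : Type} [Group G] {ρ σ : UnitaryRep G}

theorem mul_apply (g h : G) (x : ρ.H) : ρ.toHom (g * h) x = ρ.toHom g (ρ.toHom h x) := by
  rw [map_mul]; rfl

theorem one_apply (x : ρ.H) : ρ.toHom 1 x = x := by
  rw [map_one]; rfl

theorem inv_apply_apply (g : G) (x : ρ.H) : ρ.toHom g⁻¹ (ρ.toHom g x) = x := by
  rw [← mul_apply, inv_mul_cancel, one_apply]

theorem apply_inv_apply (g : G) (x : ρ.H) : ρ.toHom g (ρ.toHom g⁻¹ x) = x := by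
  rw [← mul_apply, mul_inv_cancel, one_apply]

theorem inner_apply_apply (g : G) (x y : ρ.H) : ⟪ρ.toHom g x, ρ.toHom g y⟫_ℂ = ⟪x, y⟫_ℂ :=
  (ρ.toHom g).inner_map_map x y

theorem orthogonal_invariant {K : Submodule ℂ ρ.H} (hK : ∀ g, ∀ v ∈ K, ρ.toHom g v ∈ K) (g : G) :
    ∀ v ∈ Kᗮ, ρ.toHom g v ∈ Kᗮ := by
  intro v hv u hu
  rw [← apply_inv_apply g u, inner_apply_apply]
  exact hv _ (hK _ _ hu)

/-- The linear span of the orbit of `x`. -/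
def orbitSpan (ρ : UnitaryRep G) (x : ρ.H) : Submodule ℂ ρ.H :=
  Submodule.span ℂ (Set.range fun g => ρ.toHom g x)

theorem orbitSpan_le {K : Submodule ℂ ρ.H} (hK : ∀ g, ∀ v ∈ K, ρ.toHom g v ∈ K) {x : ρ.H}
    (hx : x ∈ K) : ρ.orbitSpan x ≤ K :=
  Submodule.span_le.2 (by rintro _ ⟨g, rfl⟩; exact hK g x hx)

/-- A representation is irreducible if it has a cyclic vector which is, up to scalars, the only
vector on which the elements of some set `S` act by given scalars: the components of that vector in
a closed invariant subspace and in its complement satisfy the same equations, so one of them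
vanishes. -/
theorem isIrreducible_of_cyclic {x : ρ.H} (hx : x ≠ 0)
    (hcyc : (ρ.orbitSpan x).topologicalClosure = ⊤) (S : Set G) (a : G → ℂ)
    (hxa : ∀ g ∈ S, ρ.toHom g x = a g • x)
    (hone : ∀ y, (∀ g ∈ S, ρ.toHom g y = a g • y) → ∃ c : ℂ, y = c • x) :
    ρ.IsIrreducible := by
  have htop : ∀ K : Submodule ℂ ρ.H, IsClosed (K : Set ρ.H) →
      (∀ g, ∀ v ∈ K, ρ.toHom g v ∈ K) → x ∈ K → K = ⊤ := fun K hK hinv hxK =>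
    top_unique (hcyc.ge.trans
      (Submodule.topologicalClosure_minimal _ (orbitSpan_le hinv hxK) hK))
  refine ⟨⟨x, 0, hx⟩, fun K hK hinv => ?_⟩
  have : CompleteSpace K := hK.completeSpace_coe
  obtain ⟨p, hp, q, hq, hpq⟩ := K.exists_add_mem_mem_orthogonal x
  obtain ⟨c, hc⟩ := hone p fun g hg => by
    have h := hxa g hg
    rw [hpq, map_add, smul_add] at h
    have h' : ρ.toHom g p - a g • p = a g • q - ρ.toHom g q := by
      rw [sub_eq_sub_iff_add_eq_add, h, add_comm]
    refine sub_eq_zero.1 (inner_self_eq_zero (𝕜 := ℂ).1 ?_)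
    nth_rw 2 [h']
    exact Kᗮ.sub_mem (Kᗮ.smul_mem _ hq) (orthogonal_invariant hinv g q hq) _
      (K.sub_mem (hinv g p hp) (K.smul_mem _ hp))
  by_cases hc0 : c = 0
  · left
    have hxq : x = q := by rw [hpq, hc, hc0, zero_smul, zero_add]
    have := htop Kᗮ (Submodule.isClosed_orthogonal K) (orthogonal_invariant hinv) (hxq ▸ hq)
    rwa [Submodule.orthogonal_eq_top_iff] at this
  · right
    refine htop K hK hinv ?_
    rw [hc] at hp
    exact (K.smul_mem_iff hc0).1 hp

theorem IsIrreducible.orbitSpan_eq_top (h : ρ.IsIrreducible) [FiniteDimensional ℂ ρ.H] {x : ρ.H}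
    (hx : x ≠ 0) : ρ.orbitSpan x = ⊤ := by
  have hmem : x ∈ ρ.orbitSpan x := Submodule.subset_span ⟨1, one_apply x⟩
  refine (h.2 _ (Submodule.closed_of_finiteDimensional _) fun g v hv => ?_).resolve_left
    fun h0 => hx (by simpa [h0] using hmem)
  induction hv using Submodule.span_induction with
  | mem y hy =>
    obtain ⟨k, rfl⟩ := hy
    exact Submodule.subset_span ⟨g * k, mul_apply g k x⟩
  | zero => simp
  | add y z _ _ hy hz => rw [map_add]; exact add_mem hy hz
  | smul c y _ hy => rw [map_smul]; exact Submodule.smul_mem _ _ hy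

/-- Schur's lemma. -/
theorem IsIrreducible.exists_eq_smul (h : ρ.IsIrreducible) [FiniteDimensional ℂ ρ.H]
    (L : ρ.H →ₗ[ℂ] ρ.H) (hL : ∀ g v, L (ρ.toHom g v) = ρ.toHom g (L v)) :
    ∃ d : ℂ, ∀ v, L v = d • v := by
  have := h.1
  obtain ⟨d, hd⟩ := Module.End.exists_eigenvalue L
  refine ⟨d, fun v => ?_⟩
  have htop : Module.End.eigenspace L d = ⊤ :=
    (h.2 _ (Submodule.closed_of_finiteDimensional _) fun g v hv => by
      rw [Module.End.mem_eigenspace_iff] at hv ⊢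
      rw [hL, hv, map_smul]).resolve_left hd
  exact Module.End.mem_eigenspace_iff.1 (htop ▸ Submodule.mem_top)

end UnitaryRep

theorem UnitaryRep.equivalent_of_generators {ρ σ : UnitaryRep SolGroup} (U : ρ.H ≃ₗᵢ[ℂ] σ.H)
    (hlat : ∀ v x, U (ρ.toHom (SolGroup.lat v) x) = σ.toHom (SolGroup.lat v) (U x))
    (hgen : ∀ x, U (ρ.toHom SolGroup.gen x) = σ.toHom SolGroup.gen (U x)) : ρ.Equivalent σ := by
  refine ⟨U, fun g => ?_⟩
  induction g using SolGroup.generators_induction with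
  | hlat v => exact hlat v
  | hgen => exact hgen
  | hmul g h hg hh => intro x; rw [mul_apply, mul_apply, hg, hh]
  | hinv g hg => intro x; rw [← apply_inv_apply (ρ := ρ) g x, hg]; simp only [inv_apply_apply]

/-! ### Monomial representations attached to finite orbits of characters -/

/-- A cycle of `n` distinct characters of `ℤ²`, permuted by `α` as `χᵢ ∘ α = χᵢ₋₁` and by `μ` as
`χ₁₋ᵢ ∘ μ = χᵢ`; indices are modulo `n`. -/
structure IsCharCycle {n : ℕ} [NeZero n] (χ : Fin n → IntLattice →* Circle) : Prop where
  /-- The characters are distinct. -/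
  injective : Function.Injective χ
  /-- The action of `α`. -/
  alpha : ∀ i v, χ i (alpha v) = χ (i - 1) v
  /-- The action of `μ`. -/
  mu : ∀ i v, χ (1 - i) (mu v) = χ i v

namespace UnitaryRep

/-- On the orthonormal basis `b₀, …, bₙ₋₁` the group `ℤ²` acts diagonally through the characters
`χᵢ`, and the generator of `ℤ` by `bᵢ ↦ c bᵢ₊₁`, indices modulo `n`. -/
def IsMonomialBasis (ρ : UnitaryRep SolGroup) {n : ℕ} [NeZero n] (χ : Fin n → IntLattice →* Circle)
    (c : ℂ) (b : OrthonormalBasis (Fin n) ℂ ρ.H) : Prop :=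
  (∀ v i, ρ.toHom (SolGroup.lat v) (b i) = (χ i v : ℂ) • b i) ∧
    ∀ i, ρ.toHom SolGroup.gen (b i) = c • b (i + 1)

variable {ρ σ : UnitaryRep SolGroup} {n : ℕ} [NeZero n] {χ : Fin n → IntLattice →* Circle} {c : ℂ}
  {b : OrthonormalBasis (Fin n) ℂ ρ.H} {b' : OrthonormalBasis (Fin n) ℂ σ.H}

theorem IsMonomialBasis.equivalent (hb : ρ.IsMonomialBasis χ c b)
    (hb' : σ.IsMonomialBasis χ c b') : ρ.Equivalent σ := by
  have hU : ∀ i, b.equiv b' (Equiv.refl _) (b i) = b' i := fun i => by simp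
  refine equivalent_of_generators (b.equiv b' (Equiv.refl _)) (fun v => ?_) ?_
  · refine LinearMap.congr_fun (f := (b.equiv b' (Equiv.refl _)).toLinearEquiv.toLinearMap ∘ₗ
      (ρ.toHom (SolGroup.lat v)).toLinearEquiv.toLinearMap)
      (g := (σ.toHom (SolGroup.lat v)).toLinearEquiv.toLinearMap ∘ₗ
        (b.equiv b' (Equiv.refl _)).toLinearEquiv.toLinearMap) (b.toBasis.ext fun i => ?_)
    change b.equiv b' (Equiv.refl _) (ρ.toHom _ (b.toBasis i)) =
      σ.toHom _ (b.equiv b' (Equiv.refl _) (b.toBasis i))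
    rw [b.coe_toBasis, hb.1, map_smul, hU, hb'.1]
  · refine LinearMap.congr_fun (f := (b.equiv b' (Equiv.refl _)).toLinearEquiv.toLinearMap ∘ₗ
      (ρ.toHom SolGroup.gen).toLinearEquiv.toLinearMap)
      (g := (σ.toHom SolGroup.gen).toLinearEquiv.toLinearMap ∘ₗ
        (b.equiv b' (Equiv.refl _)).toLinearEquiv.toLinearMap) (b.toBasis.ext fun i => ?_)
    change b.equiv b' (Equiv.refl _) (ρ.toHom _ (b.toBasis i)) =
      σ.toHom _ (b.equiv b' (Equiv.refl _) (b.toBasis i))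
    rw [b.coe_toBasis, hb.2, map_smul, hU, hU, hb'.2]

theorem IsMonomialBasis.norm_eq_one (hb : ρ.IsMonomialBasis χ c b) : ‖c‖ = 1 := by
  have h := (ρ.toHom SolGroup.gen).norm_map (b 0)
  rwa [hb.2, norm_smul, b.norm_eq_one, b.norm_eq_one, mul_one] at h

theorem IsMonomialBasis.gen_pow_apply (hb : ρ.IsMonomialBasis χ c b) (k : ℕ) (i : Fin n) :
    ρ.toHom (SolGroup.gen ^ k) (b i) = c ^ k • b (i + Fin.ofNat n k) := by
  induction k with
  | zero =>
    rw [pow_zero, one_apply, pow_zero, one_smul]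
    congr 1
    ext
    simp
  | succ k ih =>
    rw [pow_succ', mul_apply, ih, map_smul, hb.2, smul_smul, ← pow_succ]
    congr 2
    ext
    simp [Fin.val_add, add_assoc]

theorem IsMonomialBasis.gen_pow_card (hb : ρ.IsMonomialBasis χ c b) (x : ρ.H) :
    ρ.toHom (SolGroup.gen ^ n) x = c ^ n • x := by
  refine LinearMap.congr_fun (f := (ρ.toHom (SolGroup.gen ^ n)).toLinearEquiv.toLinearMap)
    (g := c ^ n • LinearMap.id) (b.toBasis.ext fun i => ?_) x
  change ρ.toHom (SolGroup.gen ^ n) (b.toBasis i) = c ^ n • b.toBasis i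
  rw [b.coe_toBasis, hb.gen_pow_apply]
  congr 2
  ext
  simp

/-- A joint eigenvector of `ℤ²` with character `χᵢ` is a multiple of `bᵢ`. -/
theorem IsMonomialBasis.eq_smul (hb : ρ.IsMonomialBasis χ c b) (hχ : IsCharCycle χ) {i : Fin n}
    {y : ρ.H} (hy : ∀ v, ρ.toHom (SolGroup.lat v) y = (χ i v : ℂ) • y) : y = ⟪b i, y⟫_ℂ • b i := by
  nth_rw 1 [← b.sum_repr' y]
  refine Finset.sum_eq_single i (fun j _ hji => ?_) (by simp)
  obtain ⟨v, hv⟩ : ∃ v, χ j v ≠ χ i v := by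
    by_contra! h
    exact hji (hχ.injective (MonoidHom.ext h))
  rw [(ρ.toHom (SolGroup.lat v)).inner_eq_zero_of_eigenvector (Circle.norm_coe _) (hb.1 v j) (hy v)
    fun h => hv (Circle.ext h), zero_smul]

theorem IsMonomialBasis.isIrreducible (hb : ρ.IsMonomialBasis χ c b) (hχ : IsCharCycle χ) :
    ρ.IsIrreducible := by
  have hc : c ≠ 0 := norm_ne_zero_iff.1 (hb.norm_eq_one.symm ▸ one_ne_zero)
  refine isIrreducible_of_cyclic (x := b 0) (b.toBasis.ne_zero 0) ?_ (Set.range SolGroup.lat)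
    (fun g => (χ 0 g.left : ℂ)) ?_ ?_
  · refine top_unique (le_trans ?_ (Submodule.le_topologicalClosure _))
    rw [← b.toBasis.span_eq, Submodule.span_le]
    rintro _ ⟨i, rfl⟩
    have h := hb.gen_pow_apply i 0
    rw [show (0 : Fin n) + Fin.ofNat n i = i by simp] at h
    rw [b.coe_toBasis, ← inv_smul_smul₀ (pow_ne_zero i.val hc) (b i), ← h]
    exact Submodule.smul_mem _ _ (Submodule.subset_span ⟨_, rfl⟩)
  · rintro _ ⟨v, rfl⟩
    exact hb.1 v 0
  · intro y hy
    exact ⟨_, hb.eq_smul hχ fun v => hy _ ⟨v, rfl⟩⟩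

theorem IsMonomialBasis.equivalent_comp_phi (hb : ρ.IsMonomialBasis χ c b) (hχ : IsCharCycle χ)
    (hc : c * c = 1) : (ρ.comp phi).Equivalent ρ := by
  let b' : OrthonormalBasis (Fin n) ℂ (ρ.comp phi).H := b.reindex (Equiv.subLeft 1)
  have hb' : ∀ i, b' i = b (1 - i) := fun i => by
    have hsymm : (Equiv.subLeft (1 : Fin n)).symm i = 1 - i :=
      (Equiv.symm_apply_eq _).2 (by simp)
    rw [← hsymm]
    exact b.reindex_apply _ i
  refine IsMonomialBasis.equivalent (χ := χ) (c := c) (b := b') ⟨fun v i => ?_, fun i => ?_⟩ hb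
  · change ρ.toHom (phi (SolGroup.lat v)) (b' i) = _
    rw [hb', SolGroup.phi_lat, hb.1, hχ.mu]
    rfl
  · change ρ.toHom (phi SolGroup.gen) (b' i) = c • b' (i + 1)
    rw [hb', hb', SolGroup.phi_gen, show (1 : Fin n) - i = 1 - (i + 1) + 1 by abel]
    nth_rw 1 [← one_smul ℂ (b _), ← hc, mul_smul]
    rw [map_smul, ← hb.2, inv_apply_apply]
    rfl

/-! ### Twisted intertwiners and their characters -/

/-- A twisted intertwiner is determined up to a scalar: it maps the eigenspace of `χᵢ` to that of
`χ₁₋ᵢ`, and its relation to the generator makes all coefficients equal. -/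
theorem IsMonomialBasis.intertwiner_apply (hb : ρ.IsMonomialBasis χ c b) (hχ : IsCharCycle χ)
    (hc : c * c = 1) {S : ρ.H →ₗ[ℂ] ρ.H} (hS : IsTwistedIntertwiner phi ρ S) :
    ∃ s : ℂ, s ≠ 0 ∧ ∀ i, S (b i) = s • b (1 - i) := by
  have hc0 : c ≠ 0 := left_ne_zero_of_mul_eq_one hc
  have hdiag : ∀ i, ∃ t : ℂ, S (b i) = t • b (1 - i) := fun i =>
    ⟨_, hb.eq_smul hχ fun v => by
      have h := hS.2 (SolGroup.lat (mu.symm v)) (b i)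
      rw [hb.1, map_smul, SolGroup.phi_lat, MulEquiv.apply_symm_apply] at h
      rw [← h, ← hχ.mu i, MulEquiv.apply_symm_apply]⟩
  choose t ht using hdiag
  have hstep : ∀ i, t (i + 1) = t i := fun i => by
    have h := hS.2 SolGroup.gen (b i)
    -- `U⁻¹` is evaluated by writing `b (1 - i)` as `c • U (b (1 - (i + 1)))`, using `c² = 1`
    rw [hb.2, map_smul, ht, ht, SolGroup.phi_gen, map_smul,
      show (1 : Fin n) - i = 1 - (i + 1) + 1 by abel] at h
    nth_rw 2 [← one_smul ℂ (b _)] at h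
    rw [← hc, mul_smul, map_smul, ← hb.2, inv_apply_apply] at h
    rw [smul_smul, smul_smul, mul_comm] at h
    exact mul_right_cancel₀ hc0 (smul_left_injective ℂ (b.toBasis.ne_zero _) h)
  have hconst : ∀ k : ℕ, t (Fin.ofNat n k) = t 0 := fun k => by
    induction k with
    | zero => rfl
    | succ k ih =>
      rw [← ih, ← hstep (Fin.ofNat n k)]
      congr 1
      ext
      simp [Fin.val_add]
  have hall : ∀ i, S (b i) = t 0 • b (1 - i) := fun i => by
    rw [ht, ← hconst i, Fin.ofNat_val_eq_self]
  refine ⟨t 0, fun h0 => hS.1 (b.toBasis.ext fun i => ?_), hall⟩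
  change S (b.toBasis i) = 0
  rw [b.coe_toBasis, hall, h0, zero_smul]

/-- The trace over a monomial basis: only the indices fixed by `i ↦ 1 - (i + p)` contribute. -/
theorem IsMonomialBasis.twistedChar_eq (hb : ρ.IsMonomialBasis χ c b) {S : ρ.H →ₗ[ℂ] ρ.H} {s : ℂ}
    (hS : ∀ i, S (b i) = s • b (1 - i)) (v : IntLattice) (p : ℕ) :
    twistedChar ρ S (SolGroup.lat v * SolGroup.gen ^ p) =
      s * c ^ p * ∑ i : Fin n,
        if 1 - (i + Fin.ofNat n p) = i then (χ (i + Fin.ofNat n p) v : ℂ) else 0 := by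
  rw [twistedChar, LinearMap.trace_eq_sum_inner _ b, Finset.mul_sum]
  refine Finset.sum_congr rfl fun i _ => ?_
  change ⟪b i, S (ρ.toHom _ (b i))⟫_ℂ = _
  rw [mul_apply, hb.gen_pow_apply, map_smul, hb.1, map_smul, map_smul, hS, smul_smul, smul_smul,
    inner_smul_right, orthonormal_iff_ite.1 b.orthonormal]
  by_cases h : 1 - (i + Fin.ofNat n p) = i
  · rw [if_pos h, if_pos h.symm]; ring
  · rw [if_neg h, if_neg (Ne.symm h)]; ring

end UnitaryRep

theorem IsTwistedIntertwiner.isConstOnReidemeister {G : Type} [Group G] {φ : G ≃* G}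
    {ρ : UnitaryRep G} {S : ρ.H →ₗ[ℂ] ρ.H} (hS : IsTwistedIntertwiner φ ρ S) :
    IsConstOnReidemeister φ (twistedChar ρ S) := by
  rintro h _ ⟨g, rfl⟩
  -- cyclicity of the trace moves `ρ (φ g⁻¹)` to the left of `S`, where it cancels `ρ (φ g)`
  have hcomp : S ∘ₗ (ρ.toHom (g * h * φ g⁻¹)).toLinearEquiv.toLinearMap =
      (ρ.toHom (φ g)).toLinearEquiv.toLinearMap ∘ₗ
        (S ∘ₗ (ρ.toHom h).toLinearEquiv.toLinearMap ∘ₗ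
          (ρ.toHom (φ g⁻¹)).toLinearEquiv.toLinearMap) := by
    ext x
    change S (ρ.toHom (g * h * φ g⁻¹) x) = ρ.toHom (φ g) (S (ρ.toHom h (ρ.toHom (φ g⁻¹) x)))
    rw [UnitaryRep.mul_apply, UnitaryRep.mul_apply, hS.2]
  rw [twistedChar, twistedChar, hcomp]
  refine Eq.trans ?_ (LinearMap.trace_mul_comm ℂ (M := ρ.H) _ _)
  congr 1
  ext x
  change S (ρ.toHom h x) = S (ρ.toHom h (ρ.toHom (φ g⁻¹) (ρ.toHom (φ g) x)))
  rw [map_inv, UnitaryRep.inv_apply_apply]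

/-! ### Finite-dimensional representations fixed by the automorphism -/

theorem SolGroup.gen_pow_mul_lat (k : ℕ) (v : IntLattice) :
    gen ^ k * lat v = lat ((alpha ^ k) v) * gen ^ k := by
  induction k generalizing v with
  | zero => simp
  | succ k ih =>
    rw [pow_succ, mul_assoc, gen_mul_lat, ← mul_assoc, ih, pow_succ, MulAut.mul_apply, mul_assoc]

namespace UnitaryRep

theorem inv_mem_of_mem {G : Type} [Group G] {ρ : UnitaryRep G} [FiniteDimensional ℂ ρ.H]
    {K : Submodule ℂ ρ.H} {g : G} (hK : ∀ v ∈ K, ρ.toHom g v ∈ K) : ∀ v ∈ K, ρ.toHom g⁻¹ v ∈ K := by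
  have hmap : K.map (ρ.toHom g).toLinearEquiv.toLinearMap = K :=
    Submodule.eq_of_le_of_finrank_eq (Submodule.map_le_iff_le_comap.2 hK)
      (LinearEquiv.finrank_map_eq (ρ.toHom g).toLinearEquiv K)
  intro v hv
  rw [← hmap] at hv
  obtain ⟨w, hw, rfl⟩ := hv
  change ρ.toHom g⁻¹ (ρ.toHom g w) ∈ K
  rwa [inv_apply_apply]

theorem zpow_apply_eq_smul {G : Type} [Group G] {ρ : UnitaryRep G} {g : G} {x : ρ.H} {a : ℂ}
    (ha : a ≠ 0) (h : ρ.toHom g x = a • x) (n : ℤ) : ρ.toHom (g ^ n) x = a ^ n • x := by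
  have hinv : ρ.toHom g⁻¹ x = a⁻¹ • x := by
    rw [eq_inv_smul_iff₀ ha, ← map_smul, ← h, inv_apply_apply]
  induction n with
  | zero => simp
  | succ n ih => rw [zpow_add_one, mul_apply, h, map_smul, ih, smul_smul, zpow_add_one₀ ha,
      mul_comm]
  | pred n ih =>
    rw [zpow_sub_one, mul_apply, hinv, map_smul, ih, smul_smul, zpow_sub_one₀ ha, mul_comm]

variable {ρ : UnitaryRep SolGroup}

/-- The powers of the generator of `ℤ` move joint eigenvectors along the cycle. -/
theorem lat_gen_pow_apply {n : ℕ} [NeZero n] {χ : Fin n → IntLattice →* Circle}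
    (hχ : IsCharCycle χ) (k : ℕ) {j : Fin n} {z : ρ.H}
    (hz : ∀ v, ρ.toHom (SolGroup.lat v) z = (χ j v : ℂ) • z) (v : IntLattice) :
    ρ.toHom (SolGroup.lat v) (ρ.toHom (SolGroup.gen ^ k) z) =
      (χ (j + Fin.ofNat n k) v : ℂ) • ρ.toHom (SolGroup.gen ^ k) z := by
  induction k generalizing v with
  | zero => simpa using hz v
  | succ k ih =>
    obtain ⟨w, rfl⟩ := alpha.surjective v
    rw [pow_succ', ← mul_apply, ← mul_assoc, ← SolGroup.gen_mul_lat, mul_assoc, mul_apply,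
      mul_apply, ih, map_smul, ← mul_apply, hχ.alpha]
    congr 4
    rw [eq_sub_iff_add_eq, add_assoc]
    congr 1
    ext
    simp [Fin.val_add]

theorem lat_apply_apply {x : ρ.H} {c : IntLattice → ℂ}
    (hx : ∀ v, ρ.toHom (SolGroup.lat v) x = c v • x) (v : IntLattice) (g : SolGroup) :
    ρ.toHom (SolGroup.lat v) (ρ.toHom g x) =
      c ((alpha ^ (-g.right.toAdd)) v) • ρ.toHom g x := by
  rw [← mul_apply, SolGroup.lat_mul, mul_apply, hx, map_smul]

variable [FiniteDimensional ℂ ρ.H]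

/-- If `ℤ²` acts on `x` through one of the characters of a cycle of length `n`, and the `n`-th power
of the generator of `ℤ` is the scalar `cⁿ`, then there is a monomial basis: the vectors `cᵏ Uᵏ z`,
where `U` is the action of the generator and `z` is the normalised translate of `x` with character
`χ₀`. -/
theorem IsIrreducible.exists_isMonomialBasis (h : ρ.IsIrreducible) {n : ℕ} [NeZero n]
    {χ : Fin n → IntLattice →* Circle} (hχ : IsCharCycle χ) {c : ℂ} (hc : c * c = 1)
    (hU : ∀ w, ρ.toHom (SolGroup.gen ^ n) w = c ^ n • w) {x : ρ.H} (hx : x ≠ 0) {i : Fin n}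
    (hxi : ∀ v, ρ.toHom (SolGroup.lat v) x = (χ i v : ℂ) • x) :
    ∃ b : OrthonormalBasis (Fin n) ℂ ρ.H, ρ.IsMonomialBasis χ c b := by
  have hc1 : ‖c‖ = 1 := by
    have := congrArg norm hc
    rw [norm_mul, norm_one] at this
    exact (mul_self_eq_one_iff.1 this).resolve_right fun h => by linarith [norm_nonneg c]
  -- move the eigenvector to the character `χ₀` and normalise it
  obtain ⟨z, hz1, hz⟩ : ∃ z : ρ.H, ‖z‖ = 1 ∧
      ∀ v, ρ.toHom (SolGroup.lat v) z = (χ 0 v : ℂ) • z := by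
    have h0 := lat_gen_pow_apply hχ (-i).val hxi
    rw [Fin.ofNat_val_eq_self, add_neg_cancel] at h0
    refine ⟨(‖x‖⁻¹ : ℂ) • ρ.toHom (SolGroup.gen ^ (-i).val) x, ?_, fun v => ?_⟩
    · rw [norm_smul, LinearIsometryEquiv.norm_map]
      simp [hx]
    · rw [map_smul, h0, smul_comm]
  let y : Fin n → ρ.H := fun j => c ^ j.val • ρ.toHom (SolGroup.gen ^ j.val) z
  have hlat : ∀ v j, ρ.toHom (SolGroup.lat v) (y j) = (χ j v : ℂ) • y j := fun v j => by
    have := lat_gen_pow_apply hχ j.val hz v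
    rw [Fin.ofNat_val_eq_self, zero_add] at this
    rw [map_smul, this, smul_comm]
  have hcc : ∀ k : ℕ, c * c ^ (k + 1) = c ^ k := fun k => by
    rw [pow_succ', ← mul_assoc, hc, one_mul]
  have hgen : ∀ j, ρ.toHom SolGroup.gen (y j) = c • y (j + 1) := fun j => by
    change ρ.toHom SolGroup.gen (c ^ j.val • ρ.toHom (SolGroup.gen ^ j.val) z) =
      c • (c ^ (j + 1).val • ρ.toHom (SolGroup.gen ^ (j + 1).val) z)
    rw [map_smul, ← mul_apply, ← pow_succ', smul_smul]
    have hval : (j + 1).val = (j.val + 1) % n := by simp [Fin.val_add]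
    rcases Nat.lt_or_ge (j.val + 1) n with hj | hj
    · rw [hval, Nat.mod_eq_of_lt hj, hcc]
    · have hj' : j.val + 1 = n := by have := j.isLt; omega
      rw [hval, hj', Nat.mod_self, hU, smul_smul, pow_zero, pow_zero, one_apply, mul_one, ← hcc,
        hj', mul_assoc, ← mul_pow, hc, one_pow, mul_one]
  have hon : Orthonormal ℂ y := by
    refine ⟨fun j => ?_, fun j k hjk => ?_⟩
    · rw [norm_smul, LinearIsometryEquiv.norm_map, norm_pow, hc1, one_pow, hz1, one_mul]
    · obtain ⟨v, hv⟩ : ∃ v, χ j v ≠ χ k v := by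
        by_contra! hall
        exact hjk (hχ.injective (MonoidHom.ext hall))
      exact (ρ.toHom (SolGroup.lat v)).inner_eq_zero_of_eigenvector (Circle.norm_coe _) (hlat v j)
        (hlat v k) fun h => hv (Circle.ext h)
  have hspan : ⊤ ≤ Submodule.span ℂ (Set.range y) := by
    rw [← h.orbitSpan_eq_top (norm_ne_zero_iff.1 (hz1.symm ▸ one_ne_zero))]
    have hspan_le : ∀ g, (∀ j, ρ.toHom g (y j) ∈ Submodule.span ℂ (Set.range y)) →
        ∀ w ∈ Submodule.span ℂ (Set.range y),
          ρ.toHom g w ∈ Submodule.span ℂ (Set.range y) := fun g hg => by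
      change Submodule.span ℂ (Set.range y) ≤
        (Submodule.span ℂ (Set.range y)).comap (ρ.toHom g).toLinearEquiv.toLinearMap
      rw [Submodule.span_le]
      rintro _ ⟨j, rfl⟩
      exact hg j
    refine orbitSpan_le (fun g => ?_) (Submodule.subset_span ⟨0, by simp [y]⟩)
    induction g using SolGroup.generators_induction with
    | hlat v =>
      refine hspan_le _ fun j => ?_
      rw [hlat]
      exact Submodule.smul_mem _ _ (Submodule.subset_span ⟨j, rfl⟩)
    | hgen =>
      refine hspan_le _ fun j => ?_
      rw [hgen]
      exact Submodule.smul_mem _ _ (Submodule.subset_span ⟨j + 1, rfl⟩)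
    | hmul g h hg hh => intro w hw; rw [mul_apply]; exact hg _ (hh _ hw)
    | hinv g hg => exact inv_mem_of_mem hg
  refine ⟨OrthonormalBasis.mk hon hspan, fun v j => ?_, fun j => ?_⟩
  · rw [OrthonormalBasis.coe_mk, hlat]
  · rw [OrthonormalBasis.coe_mk, hgen]

/-- The commuting operators of `ℤ²` have a joint eigenvector. -/
theorem exists_joint_eigenvector [Nontrivial ρ.H] :
    ∃ x : ρ.H, x ≠ 0 ∧ ∃ c : IntLattice → ℂ, ∀ v, ρ.toHom (SolGroup.lat v) x = c v • x := by
  let e₁ : IntLattice := Multiplicative.ofAdd ![1, 0]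
  let e₂ : IntLattice := Multiplicative.ofAdd ![0, 1]
  let T : IntLattice → Module.End ℂ ρ.H := fun v =>
    (ρ.toHom (SolGroup.lat v)).toLinearEquiv.toLinearMap
  have hT : ∀ v x, T v x = ρ.toHom (SolGroup.lat v) x := fun _ _ => rfl
  obtain ⟨a, ha⟩ := Module.End.exists_eigenvalue (T e₁)
  have hmaps : ∀ x ∈ Module.End.eigenspace (T e₁) a, T e₂ x ∈ Module.End.eigenspace (T e₁) a := by
    intro x hx
    rw [Module.End.mem_eigenspace_iff, hT] at hx ⊢
    rw [hT, ← mul_apply, ← map_mul, mul_comm, map_mul, mul_apply, hx, map_smul]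
  have : Nontrivial (Module.End.eigenspace (T e₁) a) := Submodule.nontrivial_iff_ne_bot.2 ha
  obtain ⟨b, hb⟩ := Module.End.exists_eigenvalue ((T e₂).restrict hmaps)
  obtain ⟨⟨x, hxa⟩, hxb⟩ := hb.exists_hasEigenvector
  have hx0 : x ≠ 0 := fun h => hxb.2 (Subtype.ext h)
  have hxb' : ρ.toHom (SolGroup.lat e₂) x = b • x := congrArg Subtype.val hxb.apply_eq_smul
  have hxa' : ρ.toHom (SolGroup.lat e₁) x = a • x := Module.End.mem_eigenspace_iff.1 hxa
  have hne : ∀ {v : IntLattice} {a : ℂ}, ρ.toHom (SolGroup.lat v) x = a • x → a ≠ 0 := by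
    rintro v a h rfl
    rw [zero_smul] at h
    exact hx0 ((map_eq_zero_iff _ (ρ.toHom _).injective).1 h)
  refine ⟨x, hx0, fun v => a ^ v.toAdd 0 * b ^ v.toAdd 1, fun v => ?_⟩
  have hv : v = e₁ ^ v.toAdd 0 * e₂ ^ v.toAdd 1 := by
    apply Multiplicative.toAdd.injective
    ext i
    fin_cases i <;> simp [e₁, e₂]
  conv_lhs => rw [hv]
  rw [map_mul, map_zpow, map_zpow, mul_apply, zpow_apply_eq_smul (hne hxb') hxb', map_smul,
    zpow_apply_eq_smul (hne hxa') hxa', smul_smul, mul_comm]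

end UnitaryRep

/-! ### The two cycles of characters -/

/-- The cycle of length one consisting of the trivial character. -/
noncomputable def trivialCycle : Fin 1 → IntLattice →* Circle := fun _ => 1

/-- The cycle of length three consisting of the nontrivial characters with values in `{1, -1}`. -/
noncomputable def halfCycle : Fin 3 → IntLattice →* Circle := fun i => torusChar (orbitPoint i)

theorem isCharCycle_trivialCycle : IsCharCycle trivialCycle :=
  ⟨fun _ _ _ => Subsingleton.elim _ _, fun _ _ => rfl, fun _ _ => rfl⟩

theorem toCircle_zsmul_half (m : ℤ) :
    ((AddCircle.toCircle (m • ((1 / 2 : ℝ) : UnitAddCircle)) : Circle) : ℂ) = (-1) ^ m := by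
  have h : AddCircle.toCircle ((1 / 2 : ℝ) : UnitAddCircle) = Circle.exp Real.pi := by
    rw [AddCircle.toCircle_apply_mk]
    congr 1
    ring
  rw [AddCircle.toCircle_zsmul, h, Circle.coe_zpow, Circle.coe_exp, Complex.exp_pi_mul_I]

theorem halfCycle_apply (i : Fin 3) (v : IntLattice) :
    (halfCycle i v : ℂ) =
      ![(-1) ^ v.toAdd 1, (-1) ^ v.toAdd 0, (-1) ^ v.toAdd 0 * (-1) ^ v.toAdd 1] i := by
  have hχ : halfCycle i v =
      AddCircle.toCircle (v.toAdd 0 • orbitPoint i 0 + v.toAdd 1 • orbitPoint i 1) := rfl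
  rw [hχ, AddCircle.toCircle_add, Circle.coe_mul]
  have h0 : ((AddCircle.toCircle (v.toAdd 0 • (0 : UnitAddCircle)) : Circle) : ℂ) = 1 := by simp
  have h1 : ((AddCircle.toCircle (v.toAdd 1 • (0 : UnitAddCircle)) : Circle) : ℂ) = 1 := by simp
  fin_cases i
  · exact (congrArg₂ (· * ·) h0 (toCircle_zsmul_half _)).trans (one_mul _)
  · exact (congrArg₂ (· * ·) (toCircle_zsmul_half _) h1).trans (mul_one _)
  · exact congrArg₂ (· * ·) (toCircle_zsmul_half _) (toCircle_zsmul_half _)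

theorem isCharCycle_halfCycle : IsCharCycle halfCycle where
  injective i j hij := by
    have h0 : (halfCycle i (Multiplicative.ofAdd ![1, 0]) : ℂ) =
        halfCycle j (Multiplicative.ofAdd ![1, 0]) := by rw [hij]
    have h1 : (halfCycle i (Multiplicative.ofAdd ![0, 1]) : ℂ) =
        halfCycle j (Multiplicative.ofAdd ![0, 1]) := by rw [hij]
    rw [halfCycle_apply, halfCycle_apply] at h0 h1
    revert h0 h1
    fin_cases i <;> fin_cases j <;> norm_num
  alpha i v := by
    change torusChar (orbitPoint i) (alpha v) = torusChar (orbitPoint (i - 1)) v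
    rw [torusChar_alpha, torusAlpha_orbitPoint]
  mu i v := by
    apply Circle.ext
    obtain ⟨m, k, rfl⟩ := exists_ofAdd v
    rw [mu_ofAdd, halfCycle_apply, halfCycle_apply]
    have hinv : ((-1 : ℂ) ^ m)⁻¹ = (-1) ^ m := by rw [← inv_zpow, inv_neg_one]
    fin_cases i <;>
      simp [hinv, show (1 - 2 : Fin 3) = 2 from rfl, mul_comm]

/-! ### The four representations -/

/-- The value on `ℤ²` of a homomorphism of the form `(v, n) ↦ f(v) uⁿ`; the homomorphisms `solLift`
have this form by definition. -/
theorem lat_of_eq_mul_zpow {K : Type} [Group K] {F : SolGroup →* K} {f : IntLattice →* K} {u : K}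
    (hF : ∀ g, F g = f g.left * u ^ g.right.toAdd) (v : IntLattice) : F (SolGroup.lat v) = f v := by
  rw [hF]
  simp [SolGroup.lat]

theorem gen_of_eq_mul_zpow {K : Type} [Group K] {F : SolGroup →* K} {f : IntLattice →* K} {u : K}
    (hF : ∀ g, F g = f g.left * u ^ g.right.toAdd) : F SolGroup.gen = u := by
  rw [hF]
  simp [SolGroup.gen]

/-- The standard basis of the space of `ρ₂`. -/
noncomputable def rhoTwoBasis : OrthonormalBasis (Fin 3) ℂ rhoTwo.H :=
  EuclideanSpace.basisFun (Fin 3) ℂ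

/-- The standard basis of the space of `π`. -/
noncomputable def repPiBasis : OrthonormalBasis (Fin 1) ℂ repPi.H :=
  OrthonormalBasis.singleton (Fin 1) ℂ

theorem isMonomialBasis_rhoOne :
    rhoOne.IsMonomialBasis trivialCycle 1 (OrthonormalBasis.singleton (Fin 1) ℂ) := by
  refine ⟨fun v i => ?_, fun i => ?_⟩
  · exact (one_smul ℂ _).symm
  · rw [one_smul, Subsingleton.elim (i + 1) i]
    rfl

theorem isMonomialBasis_repPi : repPi.IsMonomialBasis trivialCycle (-1) repPiBasis := by
  have hlat : ∀ v, repPi.toHom (SolGroup.lat v) = (1 : ℂ ≃ₗᵢ[ℂ] ℂ) := fun v =>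
    lat_of_eq_mul_zpow (K := ℂ ≃ₗᵢ[ℂ] ℂ) (F := repPi.toHom) (f := 1)
      (fun _ => rfl) v
  have hgen : repPi.toHom SolGroup.gen = LinearIsometryEquiv.neg ℂ :=
    gen_of_eq_mul_zpow (K := ℂ ≃ₗᵢ[ℂ] ℂ) (F := repPi.toHom) (f := 1)
      fun _ => rfl
  refine ⟨fun v i => ?_, fun i => ?_⟩
  · rw [hlat]
    exact (one_smul ℂ _).symm
  · rw [Subsingleton.elim (i + 1) i, hgen]
    exact (neg_one_smul ℂ _).symm

theorem isMonomialBasis_rhoTwo : rhoTwo.IsMonomialBasis halfCycle 1 rhoTwoBasis := by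
  have hlat : ∀ v, rhoTwo.toHom (SolGroup.lat v) = rhoTwoDiag v := fun v =>
    lat_of_eq_mul_zpow (K := EuclideanSpace ℂ (Fin 3) ≃ₗᵢ[ℂ] EuclideanSpace ℂ (Fin 3))
      (F := rhoTwo.toHom) (f := rhoTwoDiag)
      (fun _ => rfl) v
  have hgen : rhoTwo.toHom SolGroup.gen = rhoTwoShift :=
    gen_of_eq_mul_zpow (K := EuclideanSpace ℂ (Fin 3) ≃ₗᵢ[ℂ] EuclideanSpace ℂ (Fin 3))
      (F := rhoTwo.toHom) (f := rhoTwoDiag)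
      fun _ => rfl
  have hb : ∀ i, rhoTwoBasis i = EuclideanSpace.single i (1 : ℂ) :=
    EuclideanSpace.basisFun_apply (Fin 3) ℂ
  refine ⟨fun v i => ?_, fun i => ?_⟩
  · rw [hlat, hb]
    refine PiLp.ext fun j => ?_
    change circleScalar (torusChar (orbitPoint j) v) (EuclideanSpace.single i (1 : ℂ) j) =
      (torusChar (orbitPoint i) v : ℂ) * EuclideanSpace.single i (1 : ℂ) j
    rw [circleScalar_apply, Circle.smul_def, smul_eq_mul]
    by_cases hij : j = i
    · rw [hij]
    · simp [hij]
  · rw [hgen, one_smul, hb, hb]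
    exact LinearIsometryEquiv.piLpCongrLeft_single (Equiv.addRight (1 : Fin 3)) i 1

/-- Tensoring a monomial representation with a one-dimensional representation which is trivial on
`ℤ²` only changes the scalar by which the generator of `ℤ` acts. -/
theorem UnitaryRep.IsMonomialBasis.tensor {ρ σ : UnitaryRep SolGroup} [FiniteDimensional ℂ ρ.H]
    [FiniteDimensional ℂ σ.H] {n : ℕ} [NeZero n] {χ : Fin n → IntLattice →* Circle} {c d : ℂ}
    {b : OrthonormalBasis (Fin n) ℂ ρ.H} {b' : OrthonormalBasis (Fin 1) ℂ σ.H}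
    (hb : ρ.IsMonomialBasis χ c b) (hb' : σ.IsMonomialBasis trivialCycle d b') :
    ∃ e : OrthonormalBasis (Fin n) ℂ (ρ.tensor σ).H, (ρ.tensor σ).IsMonomialBasis χ (c * d) e := by
  let e := (b.tensorProduct b').reindex (Equiv.prodUnique (Fin n) (Fin 1))
  have he : ∀ i, e i = b i ⊗ₜ[ℂ] b' 0 := fun i => by
    rw [OrthonormalBasis.reindex_apply, OrthonormalBasis.tensorProduct_apply']
    rfl
  refine ⟨e, fun v i => ?_, fun i => ?_⟩
  · change (ρ.tensor σ).toHom (SolGroup.lat v) (e i) = (χ i v : ℂ) • e i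
    rw [he]
    change ρ.toHom (SolGroup.lat v) (b i) ⊗ₜ[ℂ] σ.toHom (SolGroup.lat v) (b' 0) = _
    rw [hb.1, hb'.1]
    change _ ⊗ₜ[ℂ] (((1 : Circle) : ℂ) • b' 0) = _
    rw [Circle.coe_one, one_smul, TensorProduct.smul_tmul']
  · change (ρ.tensor σ).toHom SolGroup.gen (e i) = (c * d) • e (i + 1)
    rw [he, he]
    change ρ.toHom SolGroup.gen (b i) ⊗ₜ[ℂ] σ.toHom SolGroup.gen (b' 0) = _
    rw [hb.2, hb'.2, Subsingleton.elim ((0 : Fin 1) + 1) 0, TensorProduct.smul_tmul_smul]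

theorem exists_isMonomialBasis_tensor : ∃ b : OrthonormalBasis (Fin 3) ℂ (rhoTwo.tensor repPi).H,
    (rhoTwo.tensor repPi).IsMonomialBasis halfCycle (-1) b := by
  have h := isMonomialBasis_rhoTwo.tensor isMonomialBasis_repPi
  rwa [one_mul] at h

/-! ### Classification of the finite-dimensional fixed points -/

namespace UnitaryRep

variable {ρ : UnitaryRep SolGroup} [FiniteDimensional ℂ ρ.H]

/-- If the function `c`, through which `ℤ²` acts on `x`, is invariant under `αᵏ` along its orbit,
then the `k`-th power of the generator of `ℤ` is central in the representation, hence a scalar. -/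
theorem IsIrreducible.gen_pow_eq_smul (h : ρ.IsIrreducible) {x : ρ.H} (hx0 : x ≠ 0)
    {c : IntLattice → ℂ} (hx : ∀ v, ρ.toHom (SolGroup.lat v) x = c v • x) {k : ℕ}
    (hk : ∀ (j : ℤ) v, c ((alpha ^ j) ((alpha ^ k) v)) = c ((alpha ^ j) v)) :
    ∃ d : ℂ, ∀ w, ρ.toHom (SolGroup.gen ^ k) w = d • w := by
  have hlat : ∀ v w, ρ.toHom (SolGroup.lat ((alpha ^ k) v)) w = ρ.toHom (SolGroup.lat v) w := by
    intro v w
    have hw : w ∈ ρ.orbitSpan x := h.orbitSpan_eq_top hx0 ▸ Submodule.mem_top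
    induction hw using Submodule.span_induction with
    | mem y hy =>
      obtain ⟨g, rfl⟩ := hy
      rw [lat_apply_apply hx, lat_apply_apply hx, hk]
    | zero => simp
    | add y z _ _ hy hz => rw [map_add, map_add, hy, hz]
    | smul a y _ hy => rw [map_smul, map_smul, hy]
  have hcomm : ∀ g v, ρ.toHom (SolGroup.gen ^ k) (ρ.toHom g v) =
      ρ.toHom g (ρ.toHom (SolGroup.gen ^ k) v) := fun g => by
    induction g using SolGroup.generators_induction with
    | hlat v => intro w; rw [← mul_apply, SolGroup.gen_pow_mul_lat, mul_apply, hlat]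
    | hgen => intro w; rw [← mul_apply, ← mul_apply, pow_mul_comm']
    | hmul g h hg hh => intro w; rw [mul_apply, hg, hh, mul_apply]
    | hinv g hg =>
      intro w
      rw [← inv_apply_apply g (ρ.toHom _ (ρ.toHom g⁻¹ w)), ← hg, apply_inv_apply]
  exact h.exists_eq_smul (ρ.toHom (SolGroup.gen ^ k)).toLinearEquiv.toLinearMap hcomm

end UnitaryRep

/-- If a power of the generator of `ℤ` acts by a scalar in a representation fixed by `φ`, the square
of this scalar is one, because `φ` inverts the generator. -/
theorem UnitaryRep.mul_self_eq_one_of_gen_pow {ρ : UnitaryRep SolGroup}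
    (hfix : (ρ.comp phi).Equivalent ρ) {x : ρ.H} (hx0 : x ≠ 0) {k : ℕ} {d : ℂ}
    (hd : ∀ w, ρ.toHom (SolGroup.gen ^ k) w = d • w) : d * d = 1 := by
  obtain ⟨V, hV⟩ : ∃ V : ρ.H ≃ₗᵢ[ℂ] ρ.H, ∀ g x, V (ρ.toHom (phi g) x) = ρ.toHom g (V x) := hfix
  have hVx : V x = d • d • V x := by
    rw [← map_smul V, ← hd, ← hd, ← hV, map_pow, SolGroup.phi_gen, inv_pow, inv_apply_apply]
  have hVx0 : V x ≠ 0 := fun h0 => hx0 ((map_eq_zero_iff _ V.injective).1 h0)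
  nth_rw 1 [smul_smul, ← one_smul ℂ (V x)] at hVx
  exact (smul_left_injective ℂ hVx0 hVx).symm

namespace UnitaryRep

variable {ρ : UnitaryRep SolGroup} [FiniteDimensional ℂ ρ.H]

/-- In a fixed representation, `ℤ²` acts on a joint eigenvector through signs. Indeed the
intertwiner moves the eigenvector to one whose character is transformed by `μ`, and which cannot be
orthogonal to the whole orbit; so on this character `μ` acts like a power of `α`, and as `μ` inverts
`α` while `μ² = -1`, the character is its own inverse. -/
theorem IsIrreducible.mul_self_eq_one_of_fixed (h : ρ.IsIrreducible)
    (hfix : (ρ.comp phi).Equivalent ρ) {x : ρ.H} (hx0 : x ≠ 0) {c : IntLattice → ℂ}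
    (hx : ∀ v, ρ.toHom (SolGroup.lat v) x = c v • x) (v : IntLattice) : c v * c v = 1 := by
  have hmul : ∀ v w, c (v * w) = c v * c w := fun v w => by
    have := hx (v * w)
    rw [map_mul, mul_apply, hx w, map_smul, hx v, smul_smul, mul_comm] at this
    exact (smul_left_injective ℂ hx0 this).symm
  have hone : c 1 = 1 := by
    have := hx 1
    rw [map_one, one_apply] at this
    nth_rw 1 [← one_smul ℂ x] at this
    exact (smul_left_injective ℂ hx0 this).symm
  obtain ⟨V, hV⟩ : ∃ V : ρ.H ≃ₗᵢ[ℂ] ρ.H, ∀ g x, V (ρ.toHom (phi g) x) = ρ.toHom g (V x) := hfix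
  have hVx : ∀ v, ρ.toHom (SolGroup.lat v) (V x) = c (mu v) • V x := fun v => by
    rw [← hV, SolGroup.phi_lat, hx, map_smul]
  have hnorm : ∀ v, ‖c v‖ = 1 := fun v => by
    have := (ρ.toHom (SolGroup.lat v)).norm_map x
    rwa [hx, norm_smul, mul_eq_right₀ (norm_ne_zero_iff.2 hx0)] at this
  obtain ⟨n, hn⟩ : ∃ n : ℤ, ∀ v, c (mu v) = c ((alpha ^ n) v) := by
    by_contra! hcon
    refine hx0 ((map_eq_zero_iff _ V.injective).1 (inner_self_eq_zero (𝕜 := ℂ).1 ?_))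
    have hmem : V x ∈ ρ.orbitSpan x := h.orbitSpan_eq_top hx0 ▸ Submodule.mem_top
    change V x ∈ Submodule.span ℂ _ at hmem
    have hle : Submodule.span ℂ (Set.range fun g => ρ.toHom g x) ≤
        LinearMap.ker (innerₛₗ ℂ (V x)) := by
      rw [Submodule.span_le]
      rintro _ ⟨g, rfl⟩
      obtain ⟨v, hv⟩ := hcon (-g.right.toAdd)
      exact (ρ.toHom (SolGroup.lat v)).inner_eq_zero_of_eigenvector (hnorm _) (hVx v)
        (lat_apply_apply hx v g) hv
    exact LinearMap.mem_ker.1 (hle hmem)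
  have hinv : c v⁻¹ = c v := by
    rw [← mu_mu, hn, ← neg_neg n, ← mu_alpha_zpow, hn, ← MulAut.mul_apply, ← zpow_add,
      add_neg_cancel, zpow_zero, MulAut.one_apply]
  nth_rw 1 [← hinv]
  rw [← hmul, inv_mul_cancel, hone]

theorem IsIrreducible.isMonomialBasis_of_fixed (h : ρ.IsIrreducible)
    (hfix : (ρ.comp phi).Equivalent ρ) :
    ∃ d : ℂ, (d = 1 ∨ d = -1) ∧
      ((∃ b : OrthonormalBasis (Fin 1) ℂ ρ.H, ρ.IsMonomialBasis trivialCycle d b) ∨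
        ∃ b : OrthonormalBasis (Fin 3) ℂ ρ.H, ρ.IsMonomialBasis halfCycle d b) := by
  have := h.1
  obtain ⟨x, hx0, c, hx⟩ := exists_joint_eigenvector (ρ := ρ)
  have hsq := h.mul_self_eq_one_of_fixed hfix hx0 hx
  have hmul : ∀ v w, c (v * w) = c v * c w := fun v w => by
    have := hx (v * w)
    rw [map_mul, mul_apply, hx w, map_smul, hx v, smul_smul, mul_comm] at this
    exact (smul_left_injective ℂ hx0 this).symm
  have hne : ∀ v, c v ≠ 0 := fun v => left_ne_zero_of_mul_eq_one (hsq v)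
  -- `c` is determined by its values on the standard generators
  have hval : ∀ v, c v = c (Multiplicative.ofAdd ![1, 0]) ^ v.toAdd 0 *
      c (Multiplicative.ofAdd ![0, 1]) ^ v.toAdd 1 := fun v => by
    have hv : v = Multiplicative.ofAdd ![1, 0] ^ v.toAdd 0 *
        Multiplicative.ofAdd ![0, 1] ^ v.toAdd 1 := by
      apply Multiplicative.toAdd.injective
      ext i
      fin_cases i <;> simp
    have h1 := hx (Multiplicative.ofAdd ![1, 0] ^ v.toAdd 0)
    have h2 := hx (Multiplicative.ofAdd ![0, 1] ^ v.toAdd 1)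
    rw [map_zpow, zpow_apply_eq_smul (hne _) (hx _)] at h1 h2
    conv_lhs => rw [hv]
    rw [hmul, smul_left_injective ℂ hx0 h1, smul_left_injective ℂ hx0 h2]
  by_cases htriv : ∀ v, c v = 1
  · obtain ⟨d, hU⟩ := h.gen_pow_eq_smul hx0 hx (k := 1) fun j v => by rw [htriv, htriv]
    have hd := mul_self_eq_one_of_gen_pow hfix hx0 hU
    refine ⟨d, mul_self_eq_one_iff.1 hd, Or.inl ?_⟩
    refine h.exists_isMonomialBasis isCharCycle_trivialCycle hd (by simpa using hU) hx0 (i := 0)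
      fun v => ?_
    rw [hx, htriv]
    rfl
  · obtain ⟨d, hU⟩ := h.gen_pow_eq_smul hx0 hx (k := 3) fun j v => by
      obtain ⟨w, hw⟩ := alpha_pow_three ((alpha ^ j) v)
      have hcomm : (alpha ^ j) ((alpha ^ 3) v) = (alpha ^ 3) ((alpha ^ j) v) := by
        rw [← MulAut.mul_apply, ← MulAut.mul_apply, ← zpow_natCast, ← zpow_add, ← zpow_add,
          add_comm]
      rw [hcomm]
      change c (alpha (alpha (alpha ((alpha ^ j) v)))) = _
      rw [hw, hmul, hmul w w, hsq, mul_one]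
    obtain ⟨i, hi⟩ : ∃ i, ∀ v, c v = halfCycle i v := by
      rcases mul_self_eq_one_iff.1 (hsq (Multiplicative.ofAdd ![1, 0])) with h1 | h1 <;>
        rcases mul_self_eq_one_iff.1 (hsq (Multiplicative.ofAdd ![0, 1])) with h2 | h2
      · exact absurd (fun v => by rw [hval, h1, h2]; simp) htriv
      · exact ⟨0, fun v => by rw [hval, h1, h2, halfCycle_apply]; simp⟩
      · exact ⟨1, fun v => by rw [hval, h1, h2, halfCycle_apply]; simp⟩
      · exact ⟨2, fun v => by rw [hval, h1, h2, halfCycle_apply]; simp⟩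
    have hd := mul_self_eq_one_of_gen_pow hfix hx0 hU
    refine ⟨d, mul_self_eq_one_iff.1 hd, Or.inr ?_⟩
    refine h.exists_isMonomialBasis isCharCycle_halfCycle hd (fun w => ?_) hx0 (i := i)
      fun v => by rw [hx, hi]
    rw [hU, pow_succ, pow_two, hd, one_mul]

end UnitaryRep

/-! ### Reidemeister classes -/

/-- Representatives of the Reidemeister classes. -/
def reidemeisterRep (p : Fin 2 × Fin 2) : SolGroup :=
  SolGroup.lat (Multiplicative.ofAdd ![(p.1 : ℤ), 0]) * SolGroup.gen ^ p.2.val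

theorem lat_twist (v w : IntLattice) (k : ℕ) :
    SolGroup.lat v * (SolGroup.lat w * SolGroup.gen ^ k) * phi (SolGroup.lat v)⁻¹ =
      SolGroup.lat (v * w * (alpha ^ k) (mu v)⁻¹) * SolGroup.gen ^ k := by
  rw [map_inv, SolGroup.phi_lat, ← map_inv, mul_assoc, mul_assoc, SolGroup.gen_pow_mul_lat,
    map_mul, map_mul, mul_assoc, mul_assoc]

theorem exists_reidemeisterRep (g : SolGroup) :
    ∃ p, (reidemeisterSetoid phi) g (reidemeisterRep p) := by
  -- twisting by powers of the generator leaves an exponent equal to zero or one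
  obtain ⟨v, q, hq, hg⟩ : ∃ (v : IntLattice) (q : ℕ), q < 2 ∧
      (reidemeisterSetoid phi) g (SolGroup.lat v * SolGroup.gen ^ q) := by
    let a : SolGroup := SolGroup.gen ^ (-(g.right.toAdd / 2))
    refine ⟨(a * g * phi a⁻¹).left, (g.right.toAdd % 2).toNat, by omega, a, ?_⟩
    conv_rhs => rw [← SolGroup.lat_mul_gen_zpow (a * g * phi a⁻¹)]
    rw [← zpow_natCast, Int.toNat_of_nonneg (by omega)]
    congr 2
    have ha : phi a⁻¹ = a := by
      simp only [a]
      rw [map_inv, map_zpow, SolGroup.phi_gen, inv_zpow, inv_inv]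
    have har : a.right.toAdd = -(g.right.toAdd / 2) := by
      simp only [a]
      rw [SolGroup.gen_zpow]
      rfl
    rw [ha, SemidirectProduct.mul_right, SemidirectProduct.mul_right, toAdd_mul, toAdd_mul, har]
    omega
  obtain ⟨m, k, rfl⟩ := exists_ofAdd v
  suffices h : ∃ (e : Fin 2) (w : IntLattice), Multiplicative.ofAdd ![(e : ℤ), 0] =
      w * Multiplicative.ofAdd ![m, k] * (alpha ^ q) (mu w)⁻¹ by
    obtain ⟨e, w, hw⟩ := h
    refine ⟨(e, ⟨q, hq⟩), (reidemeisterSetoid phi).trans hg ⟨SolGroup.lat w, ?_⟩⟩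
    rw [lat_twist, ← hw]
    rfl
  obtain rfl | rfl : q = 0 ∨ q = 1 := by omega
  · refine ⟨⟨((m + k) % 2).toNat, by omega⟩,
      Multiplicative.ofAdd ![-((m + k) / 2), (m + k) / 2 - k], ?_⟩
    rw [pow_zero, MulAut.one_apply, mu_ofAdd, ← ofAdd_neg, ← ofAdd_add, ← ofAdd_add]
    congr 1
    ext i
    fin_cases i
    all_goals simp
    all_goals omega
  · refine ⟨⟨(m % 2).toNat, by omega⟩, Multiplicative.ofAdd ![-k, m / 2 - k], ?_⟩
    rw [pow_one, mu_ofAdd, map_inv, alpha_ofAdd, ← ofAdd_neg, ← ofAdd_add, ← ofAdd_add]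
    congr 1
    ext i
    fin_cases i
    all_goals simp
    all_goals omega

/-- A twist that relates two representatives comes from `ℤ²`, and changes the first coordinate by an
even number. -/
theorem reidemeisterRep_injective {p q : Fin 2 × Fin 2}
    (h : (reidemeisterSetoid phi) (reidemeisterRep p) (reidemeisterRep q)) : p = q := by
  obtain ⟨a, ha⟩ := h
  have hrep : ∀ p : Fin 2 × Fin 2, (reidemeisterRep p).right.toAdd = p.2.val := fun p => by
    rw [reidemeisterRep, ← zpow_natCast, SolGroup.gen_zpow, SemidirectProduct.mul_right,
      toAdd_mul]
    exact zero_add (p.2.val : ℤ)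
  have hphi : (phi a⁻¹).right.toAdd = a.right.toAdd := neg_neg a.right.toAdd
  have hright := congrArg (fun g : SolGroup => g.right.toAdd) ha
  simp only [SemidirectProduct.mul_right, toAdd_mul, hrep, hphi] at hright
  obtain ⟨p₁, p₂⟩ := p
  obtain ⟨q₁, q₂⟩ := q
  simp only at hright
  have h0 : a.right.toAdd = 0 := by omega
  obtain rfl : p₂ = q₂ := by omega
  have hlat : a = SolGroup.lat a.left := by
    conv_lhs => rw [← SolGroup.lat_mul_gen_zpow a, h0, zpow_zero, mul_one]
  rw [hlat, reidemeisterRep, reidemeisterRep, lat_twist] at ha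
  have hv := SemidirectProduct.inl_injective (mul_right_cancel ha)
  obtain ⟨x, y, hxy⟩ := exists_ofAdd a.left
  rw [hxy, mu_ofAdd] at hv
  have key : (q₁ : ℤ) % 2 = (p₁ : ℤ) % 2 := by
    obtain rfl | rfl : p₂ = 0 ∨ p₂ = 1 := by omega
    · rw [Fin.val_zero, pow_zero, MulAut.one_apply, ← ofAdd_neg, ← ofAdd_add, ← ofAdd_add] at hv
      have h1 := congrFun (Multiplicative.ofAdd.injective hv) 0
      have h2 := congrFun (Multiplicative.ofAdd.injective hv) 1
      simp at h1 h2
      omega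
    · rw [Fin.val_one, pow_one, map_inv, alpha_ofAdd, ← ofAdd_neg, ← ofAdd_add,
        ← ofAdd_add] at hv
      have h1 := congrFun (Multiplicative.ofAdd.injective hv) 0
      simp at h1
      omega
  rw [Prod.mk.injEq]
  exact ⟨by omega, rfl⟩

theorem card_reidemeisterClass_phi : Nat.card (ReidemeisterClass phi) = 4 := by
  have hbij : Function.Bijective fun p : Fin 2 × Fin 2 =>
      (Quotient.mk (reidemeisterSetoid phi) (reidemeisterRep p) : ReidemeisterClass phi) := by
    refine ⟨fun p q h => reidemeisterRep_injective (Quotient.exact h), fun x => ?_⟩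
    induction x using Quotient.inductionOn with
    | h g =>
      obtain ⟨p, hp⟩ := exists_reidemeisterRep g
      exact ⟨p, Quotient.sound ((reidemeisterSetoid phi).symm hp)⟩
  exact (Nat.card_eq_of_bijective _ hbij).symm.trans (by simp)

/-! ### Values of the twisted characters -/

theorem UnitaryRep.IsMonomialBasis.twistedChar_trivialCycle {ρ : UnitaryRep SolGroup} {c : ℂ}
    {b : OrthonormalBasis (Fin 1) ℂ ρ.H} (hb : ρ.IsMonomialBasis trivialCycle c b)
    (hc : c * c = 1) {S : ρ.H →ₗ[ℂ] ρ.H} (hS : IsTwistedIntertwiner phi ρ S) :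
    ∃ s : ℂ, s ≠ 0 ∧ ∀ p, twistedChar ρ S (reidemeisterRep p) = s * c ^ p.2.val := by
  obtain ⟨s, hs, hSb⟩ := hb.intertwiner_apply isCharCycle_trivialCycle hc hS
  refine ⟨s, hs, fun p => ?_⟩
  rw [reidemeisterRep, hb.twistedChar_eq hSb, Fin.sum_univ_one, if_pos (Subsingleton.elim _ _)]
  exact mul_one _

theorem UnitaryRep.IsMonomialBasis.twistedChar_halfCycle {ρ : UnitaryRep SolGroup} {c : ℂ}
    {b : OrthonormalBasis (Fin 3) ℂ ρ.H} (hb : ρ.IsMonomialBasis halfCycle c b)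
    (hc : c * c = 1) {S : ρ.H →ₗ[ℂ] ρ.H} (hS : IsTwistedIntertwiner phi ρ S) :
    ∃ s : ℂ, s ≠ 0 ∧
      ∀ p, twistedChar ρ S (reidemeisterRep p) = s * c ^ p.2.val * (-1) ^ p.1.val := by
  obtain ⟨s, hs, hSb⟩ := hb.intertwiner_apply isCharCycle_halfCycle hc hS
  refine ⟨s, hs, fun ⟨p, q⟩ => ?_⟩
  rw [reidemeisterRep, hb.twistedChar_eq hSb]
  congr 1
  simp only [halfCycle_apply, Fin.sum_univ_three]
  obtain rfl | rfl : q = 0 ∨ q = 1 := by omega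
  · rw [Fin.val_zero, show Fin.ofNat 3 0 = 0 from rfl]
    simp [show (1 - 2 : Fin 3) = 2 from rfl]
  · rw [Fin.val_one, show Fin.ofNat 3 1 = 1 from rfl]
    simp [show (1 + 1 : Fin 3) = 2 from rfl, show (2 + 1 : Fin 3) = 0 from rfl,
      show (1 - 2 : Fin 3) = 2 from rfl]

/-- On the four representatives, the functions are nonzero multiples of the rows of a Hadamard
matrix. -/
theorem linearIndependent_twistedChar {f : Fin 4 → SolGroup → ℂ} {s : Fin 4 → ℂ}
    (hs : ∀ i, s i ≠ 0) (h0 : ∀ p, f 0 (reidemeisterRep p) = s 0 * 1 ^ p.2.val)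
    (h1 : ∀ p, f 1 (reidemeisterRep p) = s 1 * 1 ^ p.2.val * (-1) ^ p.1.val)
    (h2 : ∀ p, f 2 (reidemeisterRep p) = s 2 * (-1) ^ p.2.val)
    (h3 : ∀ p, f 3 (reidemeisterRep p) = s 3 * (-1) ^ p.2.val * (-1) ^ p.1.val) :
    LinearIndependent ℂ f := by
  rw [Fintype.linearIndependent_iff]
  intro a ha
  have hval : ∀ p, a 0 * f 0 (reidemeisterRep p) + a 1 * f 1 (reidemeisterRep p) +
      a 2 * f 2 (reidemeisterRep p) + a 3 * f 3 (reidemeisterRep p) = 0 := fun p => by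
    simpa [Fin.sum_univ_four] using congrFun ha (reidemeisterRep p)
  simp only [h0, h1, h2, h3] at hval
  have e0 := hval (0, 0)
  have e1 := hval (1, 0)
  have e2 := hval (0, 1)
  have e3 := hval (1, 1)
  simp only [Fin.val_zero, Fin.val_one, pow_zero, pow_one, mul_one] at e0 e1 e2 e3
  have k0 : a 0 * s 0 = 0 := by linear_combination (e0 + e1 + e2 + e3) / 4
  have k1 : a 1 * s 1 = 0 := by linear_combination (e0 - e1 + e2 - e3) / 4
  have k2 : a 2 * s 2 = 0 := by linear_combination (e0 + e1 - e2 - e3) / 4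
  have k3 : a 3 * s 3 = 0 := by linear_combination (e0 - e1 - e2 + e3) / 4
  intro i
  fin_cases i
  · exact (mul_eq_zero.1 k0).resolve_right (hs 0)
  · exact (mul_eq_zero.1 k1).resolve_right (hs 1)
  · exact (mul_eq_zero.1 k2).resolve_right (hs 2)
  · exact (mul_eq_zero.1 k3).resolve_right (hs 3)

/-! ### The representation on `L²(𝕋²)` -/

/-- The Fourier basis of `L²(𝕋²)`. -/
noncomputable def torusBasis : HilbertBasis (Fin 2 → ℤ) ℂ TorusL2 :=
  UnitAddTorus.mFourierBasis

theorem torusBasis_coeFn (v : IntLattice) :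
    torusBasis v.toAdd =ᵐ[torusMeasure] fun t => (torusChar t v : ℂ) := by
  have h : torusBasis v.toAdd =ᵐ[torusMeasure] UnitAddTorus.mFourier v.toAdd := by
    have hb : torusBasis v.toAdd = UnitAddTorus.mFourierLp 2 v.toAdd :=
      congrFun UnitAddTorus.coe_mFourierBasis v.toAdd
    rw [hb]
    exact UnitAddTorus.coeFn_mFourierLp 2 v.toAdd
  filter_upwards [h] with t ht
  rw [ht]
  change ∏ i, fourier (v.toAdd i) (t i) =
    ((AddCircle.toCircle (v.toAdd 0 • t 0 + v.toAdd 1 • t 1) : Circle) : ℂ)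
  rw [AddCircle.toCircle_add, Circle.coe_mul, Fin.prod_univ_two, fourier_apply, fourier_apply]

theorem torusMul_basis (v w : IntLattice) :
    torusMul v (torusBasis w.toAdd) = torusBasis (v * w).toAdd := by
  refine Lp.ext ((torusMulFun_coeFn v _).trans ?_)
  filter_upwards [torusBasis_coeFn w, torusBasis_coeFn (v * w)] with t h1 h2
  rw [h1, h2, map_mul, Circle.coe_mul]

theorem torusCompAlpha_basis (v : IntLattice) :
    torusCompAlpha (torusBasis v.toAdd) = torusBasis (alpha v).toAdd := by
  refine Lp.ext ((torusCompAlpha_coeFn _).trans ?_)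
  filter_upwards [measurePreserving_torusAlpha.quasiMeasurePreserving.ae_eq_comp
    (torusBasis_coeFn v), torusBasis_coeFn (alpha v)] with t h1 h2
  simp only [Function.comp_apply] at h1
  rw [h1, h2, torusChar_alpha]

/-- The quadratic form `m² + 4mk - k²` of the symmetric matrix `A - A⁻¹` strictly increases along
every nontrivial orbit of `α`. -/
theorem alpha_quadratic_lt {v : IntLattice} (hv : v ≠ 1) :
    v.toAdd 0 ^ 2 + 4 * v.toAdd 0 * v.toAdd 1 - v.toAdd 1 ^ 2 <
      (alpha v).toAdd 0 ^ 2 + 4 * (alpha v).toAdd 0 * (alpha v).toAdd 1 -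
        (alpha v).toAdd 1 ^ 2 := by
  obtain ⟨m, k, rfl⟩ := exists_ofAdd v
  rw [alpha_ofAdd]
  simp only [toAdd_ofAdd, Matrix.cons_val_zero, Matrix.cons_val_one]
  have hne : m ≠ 0 ∨ k ≠ 0 := by
    by_contra! h
    refine hv (Multiplicative.toAdd.injective ?_)
    ext i
    fin_cases i <;> simp [h.1, h.2]
  have hpos : 0 < m ^ 2 + (m + k) ^ 2 := by
    rcases eq_or_ne m 0 with rfl | hm
    · have hk : k ≠ 0 := hne.resolve_left (by simp)
      rw [zero_add]
      positivity
    · positivity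
  linarith [show (2 * m + k) ^ 2 + 4 * (2 * m + k) * (m + k) - (m + k) ^ 2 -
    (m ^ 2 + 4 * m * k - k ^ 2) = 5 * (m ^ 2 + (m + k) ^ 2) by ring]

theorem alpha_orbit_injective {v : IntLattice} (hv : v ≠ 1) :
    Function.Injective fun j : ℕ => (alpha ^ j) v := by
  refine Function.Injective.of_comp (f := fun w : IntLattice =>
    w.toAdd 0 ^ 2 + 4 * w.toAdd 0 * w.toAdd 1 - w.toAdd 1 ^ 2)
    (StrictMono.injective (strictMono_nat_of_lt_succ fun j => ?_))
  simp only [Function.comp_apply]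
  rw [pow_succ' alpha, MulAut.mul_apply]
  exact alpha_quadratic_lt fun h => hv ((map_eq_one_iff _ (alpha ^ j).injective).1 h)

/-- Ergodicity of `α` on the torus: the Fourier coefficients of an invariant function are constant
along the orbits of `α`, and square summable, so they vanish away from the origin. -/
theorem eq_smul_of_torusCompAlpha_eq {f : TorusL2} (hf : torusCompAlpha f = f) :
    f = ⟪torusBasis 0, f⟫_ℂ • torusBasis 0 := by
  have horbit : ∀ (v : IntLattice) (j : ℕ),
      ⟪torusBasis ((alpha ^ j) v).toAdd, f⟫_ℂ = ⟪torusBasis v.toAdd, f⟫_ℂ := fun v j => by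
    induction j with
    | zero => rfl
    | succ j ih =>
      rw [pow_succ', MulAut.mul_apply, ← torusCompAlpha_basis, ← ih]
      nth_rw 1 [← hf]
      exact torusCompAlpha.inner_map_map _ _
  have hzero : ∀ v : Fin 2 → ℤ, v ≠ 0 → ⟪torusBasis v, f⟫_ℂ = 0 := fun v hv => by
    have hsum : Summable fun w => ‖⟪torusBasis w, f⟫_ℂ‖ ^ 2 :=
      torusBasis.orthonormal.inner_products_summable f
    have hconst : Summable fun _ : ℕ => ‖⟪torusBasis v, f⟫_ℂ‖ ^ 2 := by
      refine (hsum.comp_injective (i := fun j : ℕ =>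
        ((alpha ^ j) (Multiplicative.ofAdd v)).toAdd) ?_).congr fun j => ?_
      · exact Multiplicative.toAdd.injective.comp
          (alpha_orbit_injective fun h => hv (Multiplicative.ofAdd.injective h))
      · exact congrArg (fun z : ℂ => ‖z‖ ^ 2) (horbit (Multiplicative.ofAdd v) j)
    simpa using (summable_const_iff _).1 hconst
  refine (torusBasis.hasSum_repr f).unique ?_
  have h0 := hasSum_single (f := fun v => torusBasis.repr f v • torusBasis v) 0 fun v hv => by
    rw [torusBasis.repr_apply_apply, hzero v hv, zero_smul]
  rwa [torusBasis.repr_apply_apply] at h0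

theorem rhoTorus_lat (v : IntLattice) (f : TorusL2) :
    rhoTorus.toHom (SolGroup.lat v) f = torusMul v f :=
  congrArg (fun u : TorusL2 ≃ₗᵢ[ℂ] TorusL2 => u f)
    (lat_of_eq_mul_zpow (K := TorusL2 ≃ₗᵢ[ℂ] TorusL2) (F := rhoTorus.toHom) (f := torusMul)
      (fun _ => rfl) v)

theorem rhoTorus_gen (f : TorusL2) : rhoTorus.toHom SolGroup.gen f = torusCompAlpha f :=
  congrArg (fun u : TorusL2 ≃ₗᵢ[ℂ] TorusL2 => u f)
    (gen_of_eq_mul_zpow (K := TorusL2 ≃ₗᵢ[ℂ] TorusL2) (F := rhoTorus.toHom) (f := torusMul)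
      fun _ => rfl)

/-- The constant function is a cyclic vector, and the only `α`-invariant one up to scalars. -/
theorem isIrreducible_rhoTorus : rhoTorus.IsIrreducible := by
  refine UnitaryRep.isIrreducible_of_cyclic (ρ := rhoTorus) (x := torusBasis 0)
    (torusBasis.orthonormal.ne_zero 0) ?_ {SolGroup.gen} (fun _ => 1) ?_ ?_
  · refine top_unique (torusBasis.dense_span.ge.trans (Submodule.topologicalClosure_mono
      (Submodule.span_le.2 ?_)))
    rintro _ ⟨v, rfl⟩
    exact Submodule.subset_span (M := rhoTorus.H) ⟨SolGroup.lat (Multiplicative.ofAdd v),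
      (rhoTorus_lat _ _).trans ((torusMul_basis (Multiplicative.ofAdd v) 1).trans
        (by rw [mul_one]; rfl))⟩
  · rintro _ rfl
    refine ((rhoTorus_gen _).trans ((torusCompAlpha_basis 1).trans ?_)).trans (one_smul ℂ _).symm
    rw [map_one]
    rfl
  · intro f hf
    exact ⟨_, eq_smul_of_torusCompAlpha_eq
      ((rhoTorus_gen f).symm.trans ((hf _ rfl).trans (one_smul ℂ _)))⟩

theorem not_finiteDimensional_rhoTorus : ¬ FiniteDimensional ℂ rhoTorus.H := fun h => by
  have h' : FiniteDimensional ℂ TorusL2 := h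
  have := torusBasis.orthonormal.linearIndependent.finite
  exact not_finite (Fin 2 → ℤ)

/-- The Fourier basis permuted by `μ`. -/
noncomputable def torusBasisMu : HilbertBasis (Fin 2 → ℤ) ℂ TorusL2 :=
  HilbertBasis.mk (v := fun v => torusBasis (mu (Multiplicative.ofAdd v)).toAdd)
    (torusBasis.orthonormal.comp _ (Multiplicative.toAdd.injective.comp
      (mu.injective.comp Multiplicative.ofAdd.injective)))
    (by
      rw [← torusBasis.dense_span]
      refine Submodule.topologicalClosure_mono (Submodule.span_mono ?_)
      rintro _ ⟨v, rfl⟩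
      exact ⟨(mu.symm (Multiplicative.ofAdd v)).toAdd, by simp⟩)

/-- The unitary operator of `L²(𝕋²)` that permutes the Fourier basis by `μ`. -/
theorem exists_torusBasis_mu :
    ∃ V : TorusL2 ≃ₗᵢ[ℂ] TorusL2, ∀ v : IntLattice,
      V (torusBasis v.toAdd) = torusBasis (mu v).toAdd := by
  refine ⟨torusBasis.repr.trans torusBasisMu.repr.symm, fun v => ?_⟩
  have h : torusBasisMu v.toAdd = torusBasis (mu v).toAdd :=
    congrFun (HilbertBasis.coe_mk _ _) v.toAdd
  rw [← h, LinearIsometryEquiv.trans_apply, HilbertBasis.repr_self, HilbertBasis.repr_symm_single]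

theorem eq_of_eq_on_torusBasis {L M : TorusL2 ≃ₗᵢ[ℂ] TorusL2}
    (h : ∀ v : IntLattice, L (torusBasis v.toAdd) = M (torusBasis v.toAdd)) (f : TorusL2) :
    L f = M f := by
  have heq : Set.EqOn L.toContinuousLinearEquiv.toContinuousLinearMap
      M.toContinuousLinearEquiv.toContinuousLinearMap (Set.range torusBasis) := by
    rintro _ ⟨v, rfl⟩
    exact h (Multiplicative.ofAdd v)
  have hdense : Dense (Submodule.span ℂ (Set.range torusBasis) : Set TorusL2) :=
    Submodule.dense_iff_topologicalClosure_eq_top.2 torusBasis.dense_span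
  exact DFunLike.congr_fun (ContinuousLinearMap.ext_on hdense heq) f

theorem rhoTorus_equivalent_comp_phi : rhoTorus.Equivalent (rhoTorus.comp phi) := by
  obtain ⟨V, hV⟩ := exists_torusBasis_mu
  have hlat : ∀ v f, V (torusMul v f) = torusMul (mu v) (V f) := fun v =>
    eq_of_eq_on_torusBasis (L := (torusMul v).trans V) (M := V.trans (torusMul (mu v)))
      fun w => by
        rw [LinearIsometryEquiv.trans_apply, LinearIsometryEquiv.trans_apply, torusMul_basis, hV,
          hV, torusMul_basis, map_mul]
  have hgen : ∀ f, torusCompAlpha (V (torusCompAlpha f)) = V f :=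
    eq_of_eq_on_torusBasis (L := torusCompAlpha.trans (V.trans torusCompAlpha)) (M := V)
      fun w => by
        have h := DFunLike.congr_fun mu_mul_alpha w
        rw [MulAut.mul_apply, MulAut.mul_apply] at h
        rw [LinearIsometryEquiv.trans_apply, LinearIsometryEquiv.trans_apply,
          torusCompAlpha_basis, hV, torusCompAlpha_basis, hV, h, MulAut.apply_inv_self]
  refine UnitaryRep.equivalent_of_generators (ρ := rhoTorus) (σ := rhoTorus.comp phi) V
    (fun v f => ?_) fun f => ?_
  · change V (rhoTorus.toHom (SolGroup.lat v) f) = rhoTorus.toHom (phi (SolGroup.lat v)) (V f)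
    rw [SolGroup.phi_lat]
    exact (congrArg V (rhoTorus_lat v f)).trans ((hlat v f).trans (rhoTorus_lat _ _).symm)
  · change V (rhoTorus.toHom SolGroup.gen f) = rhoTorus.toHom (phi SolGroup.gen) (V f)
    have h : rhoTorus.toHom SolGroup.gen (V (rhoTorus.toHom SolGroup.gen f)) = V f :=
      (rhoTorus_gen _).trans ((congrArg (fun g => torusCompAlpha (V g)) (rhoTorus_gen f)).trans
        (hgen f))
    rw [SolGroup.phi_gen]
    exact (UnitaryRep.inv_apply_apply (ρ := rhoTorus) SolGroup.gen _).symm.trans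
      (congrArg (rhoTorus.toHom SolGroup.gen⁻¹) h)

/-! ### Points of the unitary dual -/

namespace UnitaryDual

variable {G : Type} [Group G] {ρ σ : UnitaryRep G}

theorem mk_eq_mk_iff {hρ : ρ.IsIrreducible} {hσ : σ.IsIrreducible} :
    mk ρ hρ = mk σ hσ ↔ ρ.Equivalent σ :=
  ⟨fun h => Quotient.exact h, fun h => Quotient.sound h⟩

theorem hat_mk_eq_iff {φ : G ≃* G} {hρ : ρ.IsIrreducible} :
    hat φ (mk ρ hρ) = mk ρ hρ ↔ (ρ.comp φ).Equivalent ρ :=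
  mk_eq_mk_iff

end UnitaryDual

namespace UnitaryRep.IsMonomialBasis

variable {ρ σ : UnitaryRep SolGroup} {n : ℕ} [NeZero n] {χ : Fin n → IntLattice →* Circle}
  {c d : ℂ} {b : OrthonormalBasis (Fin n) ℂ ρ.H} {b' : OrthonormalBasis (Fin n) ℂ σ.H}

theorem pow_eq_pow_of_equivalent (hb : ρ.IsMonomialBasis χ c b) (hb' : σ.IsMonomialBasis χ d b')
    (h : ρ.Equivalent σ) : c ^ n = d ^ n := by
  obtain ⟨U, hU⟩ := h
  have h0 := hU (SolGroup.gen ^ n) (b 0)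
  rw [hb.gen_pow_card, hb'.gen_pow_card, map_smul] at h0
  refine smul_left_injective ℂ (fun hz => ?_) h0
  exact b.toBasis.ne_zero 0 ((map_eq_zero_iff _ U.injective).1 hz)

end UnitaryRep.IsMonomialBasis

theorem not_equivalent_of_orthonormalBasis {G : Type} [Group G] {ρ σ : UnitaryRep G} {m n : ℕ}
    (b : OrthonormalBasis (Fin m) ℂ ρ.H) (b' : OrthonormalBasis (Fin n) ℂ σ.H) (hmn : m ≠ n) :
    ¬ ρ.Equivalent σ := fun ⟨U, _⟩ => hmn <| by
  simpa [Module.finrank_eq_card_basis b.toBasis, Module.finrank_eq_card_basis b'.toBasis] using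
    U.toLinearEquiv.finrank_eq

theorem mainTheorem3 :
    -- the four representations are irreducible
    (∃ (h₁ : rhoOne.IsIrreducible) (h₂ : rhoTwo.IsIrreducible) (hπ : repPi.IsIrreducible)
        (h₂π : (rhoTwo.tensor repPi).IsIrreducible),
      -- their classes are the finite-dimensional fixed points, and there are exactly four of these
      {x : UnitaryDual SolGroup | x.IsFiniteDim ∧ UnitaryDual.hat phi x = x} =
          {UnitaryDual.mk rhoOne h₁, UnitaryDual.mk rhoTwo h₂, UnitaryDual.mk repPi hπ,
            UnitaryDual.mk (rhoTwo.tensor repPi) h₂π} ∧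
        {x : UnitaryDual SolGroup | x.IsFiniteDim ∧ UnitaryDual.hat phi x = x}.encard = 4) ∧
    Module.finrank ℂ rhoTwo.H = 3 ∧
    -- the twisted characters
    Nat.card (ReidemeisterClass phi) = 4 ∧
    (∀ (S₁ : rhoOne.H →ₗ[ℂ] rhoOne.H) (S₂ : rhoTwo.H →ₗ[ℂ] rhoTwo.H)
        (Sπ : repPi.H →ₗ[ℂ] repPi.H)
        (S₂π : (rhoTwo.tensor repPi).H →ₗ[ℂ] (rhoTwo.tensor repPi).H),
      IsTwistedIntertwiner phi rhoOne S₁ → IsTwistedIntertwiner phi rhoTwo S₂ →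
      IsTwistedIntertwiner phi repPi Sπ → IsTwistedIntertwiner phi (rhoTwo.tensor repPi) S₂π →
      IsConstOnReidemeister phi (twistedChar rhoOne S₁) ∧
      IsConstOnReidemeister phi (twistedChar rhoTwo S₂) ∧
      IsConstOnReidemeister phi (twistedChar repPi Sπ) ∧
      IsConstOnReidemeister phi (twistedChar (rhoTwo.tensor repPi) S₂π) ∧
      LinearIndependent ℂ ![twistedChar rhoOne S₁, twistedChar rhoTwo S₂, twistedChar repPi Sπ,
        twistedChar (rhoTwo.tensor repPi) S₂π]) ∧
    -- the infinite-dimensional fixed point on `L²(𝕋²)`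
    (∃ h : rhoTorus.IsIrreducible, ¬ (UnitaryDual.mk rhoTorus h).IsFiniteDim ∧
      UnitaryDual.hat phi (UnitaryDual.mk rhoTorus h) = UnitaryDual.mk rhoTorus h) := by
  obtain ⟨b₂π, hb₂π⟩ := exists_isMonomialBasis_tensor
  have hb₁ := isMonomialBasis_rhoOne
  have hb₂ := isMonomialBasis_rhoTwo
  have hbπ := isMonomialBasis_repPi
  have h₁ := hb₁.isIrreducible isCharCycle_trivialCycle
  have h₂ := hb₂.isIrreducible isCharCycle_halfCycle
  have hπ := hbπ.isIrreducible isCharCycle_trivialCycle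
  have h₂π := hb₂π.isIrreducible isCharCycle_halfCycle
  have hone : (1 : ℂ) * 1 = 1 := one_mul 1
  have hneg : (-1 : ℂ) * -1 = 1 := by norm_num
  have hset : {x : UnitaryDual SolGroup | x.IsFiniteDim ∧ UnitaryDual.hat phi x = x} =
      {UnitaryDual.mk rhoOne h₁, UnitaryDual.mk rhoTwo h₂, UnitaryDual.mk repPi hπ,
        UnitaryDual.mk (rhoTwo.tensor repPi) h₂π} := by
    ext x
    constructor
    · rintro ⟨hfin, hfix⟩
      induction x using Quotient.inductionOn with
      | h ρ =>
        obtain ⟨ρ, hρ⟩ := ρ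
        have : FiniteDimensional ℂ ρ.H := hfin
        obtain ⟨d, rfl | rfl, ⟨b, hb⟩ | ⟨b, hb⟩⟩ :=
          hρ.isMonomialBasis_of_fixed (UnitaryDual.hat_mk_eq_iff.1 hfix)
        · exact Or.inl (UnitaryDual.mk_eq_mk_iff.2 (hb.equivalent hb₁))
        · exact Or.inr (Or.inl (UnitaryDual.mk_eq_mk_iff.2 (hb.equivalent hb₂)))
        · exact Or.inr (Or.inr (Or.inl (UnitaryDual.mk_eq_mk_iff.2 (hb.equivalent hbπ))))
        · exact Or.inr (Or.inr (Or.inr (UnitaryDual.mk_eq_mk_iff.2 (hb.equivalent hb₂π))))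
    · rintro (rfl | rfl | rfl | rfl)
      · exact ⟨inferInstanceAs (FiniteDimensional ℂ rhoOne.H), UnitaryDual.hat_mk_eq_iff.2
          (hb₁.equivalent_comp_phi isCharCycle_trivialCycle hone)⟩
      · exact ⟨inferInstanceAs (FiniteDimensional ℂ rhoTwo.H), UnitaryDual.hat_mk_eq_iff.2
          (hb₂.equivalent_comp_phi isCharCycle_halfCycle hone)⟩
      · exact ⟨inferInstanceAs (FiniteDimensional ℂ repPi.H), UnitaryDual.hat_mk_eq_iff.2
          (hbπ.equivalent_comp_phi isCharCycle_trivialCycle hneg)⟩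
      · exact ⟨b₂π.toBasis.finiteDimensional_of_finite, UnitaryDual.hat_mk_eq_iff.2
          (hb₂π.equivalent_comp_phi isCharCycle_halfCycle hneg)⟩
  have hcard : ({UnitaryDual.mk rhoOne h₁, UnitaryDual.mk rhoTwo h₂, UnitaryDual.mk repPi hπ,
      UnitaryDual.mk (rhoTwo.tensor repPi) h₂π} : Set (UnitaryDual SolGroup)).encard = 4 := by
    have n₁₂ := not_equivalent_of_orthonormalBasis (ρ := rhoOne) (σ := rhoTwo)
      (OrthonormalBasis.singleton (Fin 1) ℂ) rhoTwoBasis (by norm_num)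
    have n₁π : ¬ rhoOne.Equivalent repPi := fun h =>
      absurd (hb₁.pow_eq_pow_of_equivalent hbπ h) (by norm_num)
    have n₁₂π := not_equivalent_of_orthonormalBasis (ρ := rhoOne) (σ := rhoTwo.tensor repPi)
      (OrthonormalBasis.singleton (Fin 1) ℂ) b₂π (by norm_num)
    have n₂π := not_equivalent_of_orthonormalBasis rhoTwoBasis repPiBasis (by norm_num)
    have n₂₂π : ¬ rhoTwo.Equivalent (rhoTwo.tensor repPi) := fun h =>
      absurd (hb₂.pow_eq_pow_of_equivalent hb₂π h) (by norm_num)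
    have nπ₂π := not_equivalent_of_orthonormalBasis repPiBasis b₂π (by norm_num)
    rw [Set.encard_insert_of_notMem, Set.encard_insert_of_notMem, Set.encard_pair]
    · norm_num
    · exact fun h => nπ₂π (UnitaryDual.mk_eq_mk_iff.1 h)
    · rintro (h | h)
      · exact n₂π (UnitaryDual.mk_eq_mk_iff.1 h)
      · exact n₂₂π (UnitaryDual.mk_eq_mk_iff.1 h)
    · rintro (h | h | h)
      · exact n₁₂ (UnitaryDual.mk_eq_mk_iff.1 h)
      · exact n₁π (UnitaryDual.mk_eq_mk_iff.1 h)
      · exact n₁₂π (UnitaryDual.mk_eq_mk_iff.1 h)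
  refine ⟨⟨h₁, h₂, hπ, h₂π, hset, hset ▸ hcard⟩, ?_, card_reidemeisterClass_phi, ?_,
    isIrreducible_rhoTorus, not_finiteDimensional_rhoTorus,
    UnitaryDual.hat_mk_eq_iff.2 rhoTorus_equivalent_comp_phi.symm⟩
  · rw [Module.finrank_eq_card_basis rhoTwoBasis.toBasis, Fintype.card_fin]
  · intro S₁ S₂ Sπ S₂π i₁ i₂ iπ i₂π
    refine ⟨i₁.isConstOnReidemeister, i₂.isConstOnReidemeister, iπ.isConstOnReidemeister,
      i₂π.isConstOnReidemeister, ?_⟩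
    obtain ⟨s₁, hs₁, e₁⟩ := hb₁.twistedChar_trivialCycle hone i₁
    obtain ⟨s₂, hs₂, e₂⟩ := hb₂.twistedChar_halfCycle hone i₂
    obtain ⟨sπ, hsπ, eπ⟩ := hbπ.twistedChar_trivialCycle hneg iπ
    obtain ⟨s₂π, hs₂π, e₂π⟩ := hb₂π.twistedChar_halfCycle hneg i₂π
    refine linearIndependent_twistedChar (s := ![s₁, s₂, sπ, s₂π]) (fun i => ?_) e₁ e₂ eπ e₂π
    fin_cases i
    exacts [hs₁, hs₂, hsπ, hs₂π]
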